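/- For $k\ge 1$, a $k$-coloring of pairs is a map $c:[\omega]^2\to\{0,\dots,k-1\}$, where $[\omega]^2$ is the set of two-element subsets of $\omega$; for $x<y$ write $c(x,y)$ for $c(\{x,y\})$. It is *stable* if for every $x$ the limit $\lim_y c(x,y)$ exists, i.e. there are $j<k$ and $z$ with $c(x,y)=j$ for all $y\ge z$ with $y>x$. A set $H\subseteq\omega$ is *homogeneous* for $c$ if $c$ is constant on $[H]^2$, and $L\subseteq\omega$ is *limit-homogeneous* for a stable $c$ if there is $j<k$ with $\lim_y c(x,y)=j$ for all $x\in L$. A coloring $c$ is *low* if its Turing jump is computable from $\emptyset'$, i.e. $c'\le_T\emptyset'$ (equivalently $c'\equiv_T\emptyset'$). For $c:[\omega]^2\to 2$ let $(\ast)_c$ be the assertion: for every $k\ge 2$, every stable coloring $d:[\omega]^2\to k$ (computable from $c$ or not) has an infinite limit-homogeneous set $L$ that computes no infinite homogeneous set for $c$. The principle $\mathsf{SRT}^2_2$ (resp. $\mathsf{D}^2_2$) is the one whose instances are the stable colorings $c:[\omega]^2\to 2$ and whose solutions to $c$ are the infinite homogeneous (resp. infinite limit-homogeneous) sets for $c$.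 Finally, $\mathsf{Q}\le_c\mathsf{P}$ means that every instance $X$ of $\mathsf{Q}$ computes an instance $\widehat X$ of $\mathsf{P}$ such that for every solution $\widehat Y$ to $\widehat X$, $X\oplus\widehat Y$ computes a solution to $X$. Then: 1. There is a low stable coloring $c:[\omega]^2\to 2$ for which $(\ast)_c$ holds. 2. $\mathsf{SRT}^2_2$ and $\mathsf{D}^2_2$ are computably equivalent: $\mathsf{SRT}^2_2\le_c\mathsf{D}^2_2$ and $\mathsf{D}^2_2\le_c\mathsf{SRT}^2_2$. 3. In part 1, "low" cannot be improved to "computable": there is no computable stable coloring $c:[\omega]^2\to 2$ for which $(\ast)_c$ holds. -/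

import Mathlib

namespace StableRamsey

/-! ### Oracle computations and the Turing jump -/

/-- `f` computes `g`: the function `g` is Turing reducible to `f`. -/
def Computes (f g : ℕ → ℕ) : Prop :=
  TuringReducible (g : ℕ →. ℕ) (f : ℕ →. ℕ)

/-- The characteristic function of a set of natural numbers. -/
noncomputable def charFn (A : Set ℕ) : ℕ → ℕ :=
  A.indicator fun _ => 1

/-- The set `A` computes the set `B`. -/
def SetComputes (A B : Set ℕ) : Prop :=
  Computes (charFn A) (charFn B)

/-- Programs with an oracle: those of `Nat.Partrec.Code`, with one more instruction,
which queries the oracle. -/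
inductive OracleCode : Type
  | zero : OracleCode
  | succ : OracleCode
  | left : OracleCode
  | right : OracleCode
  | oracle : OracleCode
  | pair : OracleCode → OracleCode → OracleCode
  | comp : OracleCode → OracleCode → OracleCode
  | prec : OracleCode → OracleCode → OracleCode
  | rfind' : OracleCode → OracleCode

namespace OracleCode

/-- The partial function computed by a program with oracle `g`; the instructions have the
same meaning as in `Nat.Partrec.Code.eval`. -/
def eval (g : ℕ → ℕ) : OracleCode → ℕ →. ℕ
  | zero => pure 0
  | succ => Nat.succ
  | left => ↑fun n : ℕ => n.unpair.1
  | right => ↑fun n : ℕ => n.unpair.2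
  | oracle => ↑g
  | pair cf cg => fun n => Nat.pair <$> eval g cf n <*> eval g cg n
  | comp cf cg => fun n => eval g cg n >>= eval g cf
  | prec cf cg =>
    Nat.unpaired fun a n =>
      n.rec (eval g cf a) fun y IH => do
        let i ← IH
        eval g cg (Nat.pair a (Nat.pair y i))
  | rfind' cf =>
    Nat.unpaired fun a m =>
      (Nat.rfind fun n => (fun m => m = 0) <$> eval g cf (Nat.pair a (n + m))).map (· + m)

/-- The Gödel number of a program. -/
def encodeCode : OracleCode → ℕ
  | zero => 0
  | succ => 1
  | left => 2
  | right => 3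
  | oracle => 4
  | pair cf cg => 2 * (2 * Nat.pair (encodeCode cf) (encodeCode cg)) + 5
  | comp cf cg => 2 * (2 * Nat.pair (encodeCode cf) (encodeCode cg) + 1) + 5
  | prec cf cg => (2 * (2 * Nat.pair (encodeCode cf) (encodeCode cg)) + 1) + 5
  | rfind' cf => (2 * (2 * encodeCode cf + 1) + 1) + 5

/-- The program with a given Gödel number. -/
def ofNatCode : ℕ → OracleCode
  | 0 => zero
  | 1 => succ
  | 2 => left
  | 3 => right
  | 4 => oracle
  | n + 5 =>
    let m := n.div2.div2
    have hm : m < n + 5 := by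
      simp only [m, Nat.div2_val]
      omega
    have _m1 : m.unpair.1 < n + 5 := lt_of_le_of_lt m.unpair_left_le hm
    have _m2 : m.unpair.2 < n + 5 := lt_of_le_of_lt m.unpair_right_le hm
    match n.bodd, n.div2.bodd with
    | false, false => pair (ofNatCode m.unpair.1) (ofNatCode m.unpair.2)
    | false, true => comp (ofNatCode m.unpair.1) (ofNatCode m.unpair.2)
    | true, false => prec (ofNatCode m.unpair.1) (ofNatCode m.unpair.2)
    | true, true => rfind' (ofNatCode m)
decreasing_by all_goals first | exact hm | exact _m1 | exact _m2

theorem ofNatCode_encodeCode (c : OracleCode) : ofNatCode (encodeCode c) = c := by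
  induction c <;> simp [encodeCode, ofNatCode, Nat.div2_val, *]

theorem encodeCode_ofNatCode : ∀ n, encodeCode (ofNatCode n) = n
  | 0 => by simp [ofNatCode, encodeCode]
  | 1 => by simp [ofNatCode, encodeCode]
  | 2 => by simp [ofNatCode, encodeCode]
  | 3 => by simp [ofNatCode, encodeCode]
  | 4 => by simp [ofNatCode, encodeCode]
  | n + 5 => by
    let m := n.div2.div2
    have hm : m < n + 5 := by
      simp only [m, Nat.div2_val]
      omega
    have _m1 : m.unpair.1 < n + 5 := lt_of_le_of_lt m.unpair_left_le hm
    have _m2 : m.unpair.2 < n + 5 := lt_of_le_of_lt m.unpair_right_le hm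
    have IH := encodeCode_ofNatCode m
    have IH1 := encodeCode_ofNatCode m.unpair.1
    have IH2 := encodeCode_ofNatCode m.unpair.2
    conv_rhs => rw [← Nat.bit_bodd_div2 n, ← Nat.bit_bodd_div2 n.div2]
    simp only [ofNatCode.eq_6]
    cases n.bodd <;> cases n.div2.bodd <;>
      simp [m, encodeCode, IH, IH1, IH2, Nat.bit_val]
decreasing_by all_goals first | exact hm | exact _m1 | exact _m2

end OracleCode

/-- The Turing jump of `f`: the set of all `e` such that the program number `e`, run with
oracle `f` on input `e`, halts. -/
def jump (f : ℕ → ℕ) : Set ℕ :=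
  {e | ((OracleCode.ofNatCode e).eval f e).Dom}

/-- `f` is low: the jump of `f` is computable from the jump of the empty set. -/
def Low (f : ℕ → ℕ) : Prop :=
  SetComputes (jump (charFn ∅)) (jump f)

/-! ### Colorings of pairs -/

/-- A `k`-coloring of the two-element sets of natural numbers. -/
abbrev Coloring (k : ℕ) : Type :=
  Set.powersetCard ℕ 2 → Fin k

namespace Coloring

variable {k : ℕ}

/-- `c.color h` is the color `c(x, y)` of the pair `x < y`. -/
def color (c : Coloring k) {x y : ℕ} (h : x < y) : Fin k :=
  c ⟨{x, y}, Finset.card_pair h.ne⟩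

/-- The coloring as a function on the natural numbers, pairs `x < y` being coded by
`Nat.pair x y` (and `0` at the numbers that code no such pair). -/
def code (c : Coloring k) : ℕ → ℕ := fun n =>
  if h : n.unpair.1 < n.unpair.2 then (c.color h : ℕ) else 0

/-- `H` is homogeneous for `c`: all two-element subsets of `H` have the same color. -/
def IsHomogeneous (c : Coloring k) (H : Set ℕ) : Prop :=
  ∃ j : Fin k, ∀ F : Set.powersetCard ℕ 2, ((F : Finset ℕ) : Set ℕ) ⊆ H → c F = j

/-- `lim_y c(x, y) = j`. -/
def HasLimit (c : Coloring k) (x : ℕ) (j : Fin k) : Prop :=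
  ∃ z, ∀ (y : ℕ) (h : x < y), z ≤ y → c.color h = j

/-- `c` is stable: `lim_y c(x, y)` exists for every `x`. -/
def IsStable (c : Coloring k) : Prop :=
  ∀ x, ∃ j, c.HasLimit x j

/-- `L` is limit-homogeneous for `c`: all `x ∈ L` have the same limit color. -/
def IsLimitHomogeneous (c : Coloring k) (L : Set ℕ) : Prop :=
  ∃ j, ∀ x ∈ L, c.HasLimit x j

end Coloring

/-! ### Principles and computable reducibility -/

/-- An instance-solution principle, with instances and solutions given as functions on the
natural numbers. -/
structure Principle where
  /-- The instances. -/
  Instances : Set (ℕ → ℕ)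
  /-- The solutions to an instance. -/
  Solutions : (ℕ → ℕ) → Set (ℕ → ℕ)

/-- Computable reducibility `Q ≤_c P`: every instance `X` of `Q` computes an instance `X'` of
`P` such that for every solution `Y'` to `X'`, the functions `X` and `Y'` together compute a
solution `Y` to `X`. -/
def ComputablyReducible (Q P : Principle) : Prop :=
  ∀ X ∈ Q.Instances, ∃ X' ∈ P.Instances, Computes X X' ∧
    ∀ Y' ∈ P.Solutions X', ∃ Y ∈ Q.Solutions X,
      RecursiveIn {(X : ℕ →. ℕ), (Y' : ℕ →. ℕ)} (Y : ℕ →. ℕ)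

/-- Stable Ramsey's theorem for pairs and `k` colors: every stable `k`-coloring of pairs has
an infinite homogeneous set. -/
def SRT2 (k : ℕ) : Principle where
  Instances := {X | ∃ c : Coloring k, c.IsStable ∧ X = c.code}
  Solutions X := {Y | ∃ c : Coloring k, X = c.code ∧
    ∃ H : Set ℕ, H.Infinite ∧ c.IsHomogeneous H ∧ Y = charFn H}

/-- The principle that every stable `k`-coloring of pairs has an infinite limit-homogeneous
set. -/
def D2 (k : ℕ) : Principle where
  Instances := {X | ∃ c : Coloring k, c.IsStable ∧ X = c.code}
  Solutions X := {Y | ∃ c : Coloring k, X = c.code ∧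
    ∃ L : Set ℕ, L.Infinite ∧ c.IsLimitHomogeneous L ∧ Y = charFn L}

/-- The coloring `c` of pairs has the property that for every `k ≥ 2`, every stable
`k`-coloring of pairs has an infinite limit-homogeneous set that computes no infinite
homogeneous set for `c`. -/
def AvoidsAllStable (c : Coloring 2) : Prop :=
  ∀ k : ℕ, 2 ≤ k → ∀ d : Coloring k, d.IsStable →
    ∃ L : Set ℕ, L.Infinite ∧ d.IsLimitHomogeneous L ∧
      ∀ H : Set ℕ, H.Infinite → c.IsHomogeneous H → ¬ SetComputes L H

end StableRamsey

open StableRamsey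

/-! Fix an infinite set `B` of boundaries and give `x < y` color `1` exactly when a boundary lies in
`(x, y]`. All limit colors are `1`, so an infinite homogeneous set has color `1`, and any two of its
elements are separated by a boundary. Such a set therefore computes, for each `n`, a bound for some
element of `B` that is at least `n`. If `B` is hyperimmune relative to `L`, then `L` computes no
infinite homogeneous set (`HyperimmuneIn.not_setComputes`).

Part 1 thus rests on two facts. A finite extension argument below the halting set yields a
hyperimmune `B` whose coloring is low (`exists_low_boundary`). And for an arbitrary partition of the
natural numbers into finitely many classes, some class has an infinite subset relative to which `B`
is still hyperimmune (`HyperimmuneIn.exists_monochromatic`). The latter is applied to the classes of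
equal limit color of `d`; nothing effective is asked of the partition, so `d` can be arbitrary.

Preservation is proved by Mathias forcing that builds a set on each side of a two-class partition
and meets, for each pair of requirements, one of the two. A query about all partitions at once
replaces the given, possibly complicated one; when the answer is negative, a basis theorem for `Π⁰₁`
classes (`HyperimmuneIn.exists_mem_class`) supplies a harmless partition with which to thin the
reservoir.

Parts 2 and 3 both follow from greedy thinning: a limit-homogeneous set together with the coloring
computes a homogeneous set (`IsLimitHomogeneous.exists_isHomogeneous`). -/

namespace StableRamsey

open Encodable Denumerable
open Nat.Partrec (Code)

/-! ### A universal machine for oracle programs -/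

namespace OracleCode

theorem mem_rfind_map_eq_zero {f : ℕ → Part ℕ} {v : ℕ} :
    v ∈ Nat.rfind (fun k => (f k).map fun m => decide (m = 0)) ↔
      0 ∈ f v ∧ ∀ k < v, ∃ w ∈ f k, w ≠ 0 := by
  refine Nat.mem_rfind.trans (and_congr ?_ (forall_congr' fun k => imp_congr_right fun _ => ?_)) <;>
    simp only [Part.mem_map_iff, decide_eq_true_iff, decide_eq_false_iff_not, exists_eq_right, ne_eq]

/-- Evaluation of an oracle program relative to a partial oracle. -/
def evalPartial (o : ℕ →. ℕ) : OracleCode → ℕ →. ℕ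
  | zero => fun _ => Part.some 0
  | succ => fun n => Part.some (n + 1)
  | left => fun n => Part.some n.unpair.1
  | right => fun n => Part.some n.unpair.2
  | oracle => o
  | pair cf cg => fun n =>
    (evalPartial o cf n).bind fun a => (evalPartial o cg n).map (Nat.pair a)
  | comp cf cg => fun n => (evalPartial o cg n).bind fun a => evalPartial o cf a
  | prec cf cg => fun n =>
    Nat.rec (evalPartial o cf n.unpair.1)
      (fun y IH => IH.bind fun i => evalPartial o cg (Nat.pair n.unpair.1 (Nat.pair y i)))
      n.unpair.2
  | rfind' cf => fun n =>
    (Nat.rfind fun k =>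
      (evalPartial o cf (Nat.pair n.unpair.1 (k + n.unpair.2))).map fun m => decide (m = 0)).map
      (· + n.unpair.2)

theorem evalPartial_coe (g : ℕ → ℕ) (c : OracleCode) : evalPartial (↑g) c = eval g c := by
  induction c with
  | zero | succ | left | right | oracle => rfl
  | pair cf cg hf hg =>
    funext n
    simp only [evalPartial, eval, hf, hg, Seq.seq, Part.map_eq_map, Part.bind_map]
  | comp cf cg hf hg => simp only [evalPartial, eval, hf, hg]; rfl
  | prec cf cg hf hg => simp only [evalPartial, eval, hf, hg]; rfl
  | rfind' cf hf => simp only [evalPartial, eval, hf]; rfl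

theorem evalPartial_mono {o o' : ℕ →. ℕ} (h : ∀ n v, v ∈ o n → v ∈ o' n) (c : OracleCode) :
    ∀ n v, v ∈ evalPartial o c n → v ∈ evalPartial o' c n := by
  induction c with
  | zero | succ | left | right => exact fun _ _ hv => hv
  | oracle => exact h
  | pair cf cg hf hg =>
    intro n v hv
    simp only [evalPartial, Part.mem_bind_iff, Part.mem_map_iff] at hv ⊢
    obtain ⟨a, ha, b, hb, rfl⟩ := hv
    exact ⟨a, hf _ _ ha, b, hg _ _ hb, rfl⟩
  | comp cf cg hf hg =>
    intro n v hv
    simp only [evalPartial, Part.mem_bind_iff] at hv ⊢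
    obtain ⟨a, ha, hv⟩ := hv
    exact ⟨a, hg _ _ ha, hf _ _ hv⟩
  | prec cf cg hf hg =>
    intro n v hv
    simp only [evalPartial] at hv ⊢
    generalize n.unpair.2 = m at hv ⊢
    induction m generalizing v with
    | zero => exact hf _ _ hv
    | succ y ih =>
      simp only [Part.mem_bind_iff] at hv ⊢
      obtain ⟨a, ha, hv⟩ := hv
      exact ⟨a, ih _ ha, hg _ _ hv⟩
  | rfind' cf hf =>
    intro n v hv
    simp only [evalPartial, Part.mem_map_iff, mem_rfind_map_eq_zero] at hv ⊢
    obtain ⟨a, ⟨ha, hlt⟩, rfl⟩ := hv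
    refine ⟨a, ⟨hf _ _ ha, fun k hk => ?_⟩, rfl⟩
    obtain ⟨b, hb, hb0⟩ := hlt k hk
    exact ⟨b, hf _ _ hb, hb0⟩

/-- The use principle: a halting computation asks only finitely many oracle questions, so one stage
of an increasing approximation answers them all. -/
theorem evalPartial_continuous {o : ℕ →. ℕ} {a : ℕ → ℕ →. ℕ}
    (hmono : ∀ i j, i ≤ j → ∀ n v, v ∈ a i n → v ∈ a j n)
    (hsup : ∀ n v, v ∈ o n → ∃ i, v ∈ a i n) (c : OracleCode) :
    ∀ n v, v ∈ evalPartial o c n → ∃ i, v ∈ evalPartial (a i) c n := by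
  have up : ∀ {c i j n v}, i ≤ j → v ∈ evalPartial (a i) c n → v ∈ evalPartial (a j) c n :=
    fun {c i j n v} hij => evalPartial_mono (hmono i j hij) c n v
  induction c with
  | zero | succ | left | right => exact fun _ _ hv => ⟨0, hv⟩
  | oracle => exact hsup
  | pair cf cg hf hg =>
    intro n v hv
    simp only [evalPartial, Part.mem_bind_iff, Part.mem_map_iff] at hv ⊢
    obtain ⟨a, ha, b, hb, rfl⟩ := hv
    obtain ⟨i, hi⟩ := hf _ _ ha
    obtain ⟨j, hj⟩ := hg _ _ hb
    exact ⟨max i j, a, up (le_max_left _ _) hi, b, up (le_max_right _ _) hj, rfl⟩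
  | comp cf cg hf hg =>
    intro n v hv
    simp only [evalPartial, Part.mem_bind_iff] at hv ⊢
    obtain ⟨a, ha, hv⟩ := hv
    obtain ⟨i, hi⟩ := hg _ _ ha
    obtain ⟨j, hj⟩ := hf _ _ hv
    exact ⟨max i j, a, up (le_max_left _ _) hi, up (le_max_right _ _) hj⟩
  | prec cf cg hf hg =>
    intro n v hv
    simp only [evalPartial] at hv ⊢
    generalize n.unpair.2 = m at hv ⊢
    induction m generalizing v with
    | zero => exact hf _ _ hv
    | succ y ih =>
      simp only [Part.mem_bind_iff] at hv ⊢
      obtain ⟨b, hb, hv⟩ := hv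
      obtain ⟨i, hi⟩ := ih _ hb
      obtain ⟨j, hj⟩ := hg _ _ hv
      refine ⟨max i j, b, ?_, up (le_max_right _ _) hj⟩
      have := evalPartial_mono (hmono i _ (le_max_left i j)) (prec cf cg)
        (Nat.pair n.unpair.1 y) b
      simp only [evalPartial, Nat.unpair_pair] at this
      exact this hi
  | rfind' cf hf =>
    intro n v hv
    simp only [evalPartial, Part.mem_map_iff, mem_rfind_map_eq_zero] at hv ⊢
    obtain ⟨b, ⟨hw, hlt⟩, rfl⟩ := hv
    obtain ⟨i, hi⟩ := hf _ _ hw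
    -- Each rejected candidate is settled at a stage of its own; since there are finitely many,
    -- induction gives a common one.
    have key : ∀ l ≤ b, ∃ j, ∀ k < l, ∃ w,
        w ∈ evalPartial (a j) cf (Nat.pair n.unpair.1 (k + n.unpair.2)) ∧
          w ≠ 0 := by
      intro l
      induction l with
      | zero => exact fun _ => ⟨0, by simp⟩
      | succ l ih =>
        intro hl
        obtain ⟨j, hj⟩ := ih (by omega)
        obtain ⟨w, hw, hw0⟩ := hlt l (by omega)
        obtain ⟨j', hj'⟩ := hf _ _ hw
        refine ⟨max j j', fun k hk => ?_⟩
        rcases Nat.lt_succ_iff_lt_or_eq.1 hk with hk | rfl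
        · obtain ⟨w, hw, hw0⟩ := hj k hk
          exact ⟨w, up (le_max_left _ _) hw, hw0⟩
        · exact ⟨w, up (le_max_right _ _) hj', hw0⟩
    obtain ⟨j, hj⟩ := key b le_rfl
    refine ⟨max i j, b, ⟨up (le_max_left _ _) hi, fun k hk => ?_⟩, rfl⟩
    obtain ⟨w, hw, hw0⟩ := hj k hk
    exact ⟨w, up (le_max_right _ _) hw, hw0⟩

/-- Evaluation of an oracle program relative to a finite initial segment of an oracle. -/
def evalList (σ : List ℕ) : OracleCode → ℕ →. ℕ :=
  evalPartial fun n => (σ[n]? : Part ℕ)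

end OracleCode

/-! ### Initial segments as finite oracles, and the universal interpreter -/

/-- The list of the first `m` values of `X`. -/
def initSeg {α : Type*} (X : ℕ → α) (m : ℕ) : List α := (List.range m).map X

@[simp] theorem length_initSeg {α : Type*} (X : ℕ → α) (m : ℕ) : (initSeg X m).length = m := by
  simp [initSeg]

theorem getElem?_initSeg {α : Type*} (X : ℕ → α) (m n : ℕ) :
    (initSeg X m)[n]? = if n < m then some (X n) else none := by
  by_cases h : n < m <;> simp [initSeg, h]

theorem take_initSeg {α : Type*} (X : ℕ → α) {k m : ℕ} (h : k ≤ m) :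
    (initSeg X m).take k = initSeg X k := by
  simp [initSeg, ← List.map_take, List.take_range, h]

theorem initSeg_prefix {α : Type*} (X : ℕ → α) {k m : ℕ} (h : k ≤ m) :
    initSeg X k <+: initSeg X m :=
  take_initSeg X h ▸ List.take_prefix _ _

namespace OracleCode

theorem evalList_mono {σ τ : List ℕ} (h : σ <+: τ) {c : OracleCode} {n v : ℕ}
    (hv : v ∈ evalList σ c n) : v ∈ evalList τ c n := by
  refine evalPartial_mono (fun n v hv => ?_) c n v hv
  simp only [Part.mem_coe, Option.mem_def] at hv ⊢
  obtain ⟨ρ, rfl⟩ := h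
  rw [List.getElem?_append_left (List.getElem?_eq_some_iff.1 hv).1, hv]

theorem mem_eval_iff {g : ℕ → ℕ} {c : OracleCode} {n v : ℕ} :
    v ∈ eval g c n ↔ ∃ m, v ∈ evalList (initSeg g m) c n := by
  rw [← evalPartial_coe]
  constructor
  · refine evalPartial_continuous (a := fun m n => ((initSeg g m)[n]? : Part ℕ)) ?_ ?_ c n v
    · intro i j hij n v hv
      simp only [getElem?_initSeg, Part.mem_coe, Option.mem_def] at hv ⊢
      split_ifs at hv with h
      rw [if_pos (by omega), hv]
    · intro n v hv
      refine ⟨n + 1, ?_⟩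
      rw [getElem?_initSeg, if_pos n.lt_succ_self]
      simpa using hv
  · rintro ⟨m, hm⟩
    refine evalPartial_mono (fun n v hv => ?_) c n v hm
    simp only [getElem?_initSeg, Part.mem_coe, Option.mem_def] at hv
    split_ifs at hv
    simpa [eq_comm] using hv

/-- One unfolding of the interpreter of oracle programs; `U e n` stands for the value of the
program number `e` at `n`. -/
def interpreterStep (U : ℕ → ℕ → Part ℕ) (e : ℕ) (σ : List ℕ) (n : ℕ) : Part ℕ :=
  bif e == 0 then Part.some 0
  else bif e == 1 then Part.some (n + 1)
  else bif e == 2 then Part.some n.unpair.1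
  else bif e == 3 then Part.some n.unpair.2
  else bif e == 4 then (σ[n]? : Part ℕ)
  else bif (e - 5).bodd then
    bif (e - 5).div2.bodd then
      (Nat.rfind fun k =>
        (U (e - 5).div2.div2 (Nat.pair n.unpair.1 (k + n.unpair.2))).map
          fun m => decide (m = 0)).map (· + n.unpair.2)
    else
      Nat.rec (U (e - 5).div2.div2.unpair.1 n.unpair.1)
        (fun y IH => IH.bind fun i =>
          U (e - 5).div2.div2.unpair.2 (Nat.pair n.unpair.1 (Nat.pair y i)))
        n.unpair.2
  else
    bif (e - 5).div2.bodd then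
      (U (e - 5).div2.div2.unpair.2 n).bind fun a => U (e - 5).div2.div2.unpair.1 a
    else
      (U (e - 5).div2.div2.unpair.1 n).bind fun a =>
        (U (e - 5).div2.div2.unpair.2 n).map (Nat.pair a)

/-- One unfolding calls `U` only on proper subprograms, so the fixed-point equation determines `U`
by induction on the program. -/
theorem eq_evalList_of_fixed {U : ℕ → ℕ → Part ℕ} {σ : List ℕ}
    (hU : ∀ e n, U e n = interpreterStep U e σ n) (e n : ℕ) :
    U e n = evalList σ (ofNatCode e) n := by
  suffices ∀ c : OracleCode, ∀ n, U (encodeCode c) n = evalList σ c n by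
    rw [← this, encodeCode_ofNatCode]
  intro c
  induction c with
  | zero | succ | left | right | oracle =>
    intro n; rw [hU]; simp [encodeCode, interpreterStep, evalList, evalPartial]
  | pair cf cg hf hg =>
    intro n; rw [hU]
    simp [encodeCode, interpreterStep, evalList, evalPartial, Nat.div2_val, hf, hg]
  | comp cf cg hf hg =>
    intro n; rw [hU]
    simp [encodeCode, interpreterStep, evalList, evalPartial, Nat.div2_val, hf, hg]
  | prec cf cg hf hg =>
    intro n; rw [hU]
    simp [encodeCode, interpreterStep, evalList, evalPartial, Nat.div2_val, hf, hg]
  | rfind' cf hf =>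
    intro n; rw [hU]
    simp [encodeCode, interpreterStep, evalList, evalPartial, Nat.div2_val, hf]

theorem partrec_interpreterStep {α : Type*} [Primcodable α] {U : α → ℕ → ℕ → Part ℕ}
    (hU : Partrec fun a : α × ℕ × ℕ => U a.1 a.2.1 a.2.2) {e n : α → ℕ} {σ : α → List ℕ}
    (he : Computable e) (hσ : Computable σ) (hn : Computable n) :
    Partrec fun a => interpreterStep (U a) (e a) (σ a) (n a) := by
  have beq : ∀ k, Computable fun a => e a == k := fun k =>
    (Primrec.beq.to_comp : Computable₂ _).comp he (Computable.const k)
  have e5 : Computable fun a => e a - 5 :=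
    Primrec.nat_sub.to_comp.comp he (Computable.const 5)
  have d1 := Computable.nat_div2.comp e5
  have d2 := Computable.nat_div2.comp d1
  have n1 := Computable.fst.comp (Computable.unpair.comp hn)
  have n2 := Computable.snd.comp (Computable.unpair.comp hn)
  have l := Computable.fst.comp (Computable.unpair.comp d2)
  have r := Computable.snd.comp (Computable.unpair.comp d2)
  have pr : Computable₂ Nat.pair := Primrec₂.natPair.to_comp
  have hU' : ∀ {β : Type _} [Primcodable β] {f : β → α} {g h : β → ℕ}, Computable f →
      Computable g → Computable h → Partrec fun b => U (f b) (g b) (h b) :=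
    fun hf hg hh => hU.comp (hf.pair (hg.pair hh))
  unfold interpreterStep
  refine .cond (beq 0) (Computable.const 0) <| .cond (beq 1) (Computable.succ.comp hn) <|
    .cond (beq 2) n1 <| .cond (beq 3) n2 <|
    .cond (beq 4) (Computable.list_getElem?.comp hσ hn).ofOption <|
    .cond (Computable.nat_bodd.comp e5)
      (.cond (Computable.nat_bodd.comp d1) ?_ ?_) (.cond (Computable.nat_bodd.comp d1) ?_ ?_)
  · refine Partrec.map (Partrec.rfind (Partrec.map (hU' Computable.fst (d2.comp Computable.fst)
      (pr.comp (n1.comp Computable.fst) ?_)) ?_)) ?_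
    · exact Primrec.nat_add.to_comp.comp Computable.snd (n2.comp Computable.fst)
    · exact (Primrec.eq.decide.to_comp.comp Computable.snd (Computable.const 0)).to₂
    · exact (Primrec.nat_add.to_comp.comp Computable.snd (n2.comp Computable.fst)).to₂
  · refine Partrec.nat_rec n2 (hU' Computable.id l n1) (h := fun a p => U a
      (e a - 5).div2.div2.unpair.2 (Nat.pair (n a).unpair.1 (Nat.pair p.1 p.2))) ?_
    exact hU' Computable.fst (r.comp Computable.fst) (pr.comp (n1.comp Computable.fst)
      (pr.comp (Computable.fst.comp Computable.snd) (Computable.snd.comp Computable.snd)))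
  · exact Partrec.bind (hU' Computable.id r hn)
      (hU' Computable.fst (l.comp Computable.fst) Computable.snd)
  · refine Partrec.bind (hU' Computable.id l hn) (Partrec.map (hU' Computable.fst
      (r.comp Computable.fst) (hn.comp Computable.fst)) ?_)
    exact (pr.comp (Computable.snd.comp Computable.fst) Computable.snd).to₂

/-- Kleene's recursion theorem supplies a partial recursive fixed point of the interpreter, and
every fixed point is the evaluation map by `eq_evalList_of_fixed`. -/
theorem partrec_evalList :
    Partrec fun x : ℕ × List ℕ × ℕ => evalList x.2.1 (ofNatCode x.1) x.2.2 := by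
  let U : Code × List ℕ → ℕ → ℕ → Part ℕ := fun a e n => a.1.eval (encode (e, a.2, n))
  have hU : Partrec fun a : (Code × List ℕ) × ℕ × ℕ => U a.1 a.2.1 a.2.2 := by
    refine Code.eval_part.comp (Computable.fst.comp Computable.fst) ?_
    exact Computable.encode.comp ((Computable.fst.comp Computable.snd).pair
      ((Computable.snd.comp Computable.fst).pair (Computable.snd.comp Computable.snd)))
  let D : ℕ → ℕ × List ℕ × ℕ := ofNat (ℕ × List ℕ × ℕ)
  have hD : Computable D := Computable.ofNat _
  obtain ⟨p, hp⟩ := Code.fixed_point₂ (f := fun p x =>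
    interpreterStep (U (p, (D x).2.1)) (D x).1 (D x).2.1 (D x).2.2) <| by
      have hx : Computable fun a : Code × ℕ => D a.2 := hD.comp Computable.snd
      have := partrec_interpreterStep (U := fun a : Code × ℕ => U (a.1, (D a.2).2.1))
        (e := fun a => (D a.2).1) (σ := fun a => (D a.2).2.1) (n := fun a => (D a.2).2.2)
        (hU.comp (((Computable.fst.comp Computable.fst).pair
          (Computable.fst.comp (Computable.snd.comp (hx.comp Computable.fst)))).pair
            Computable.snd))
        (Computable.fst.comp hx) (Computable.fst.comp (Computable.snd.comp hx))
        (Computable.snd.comp (Computable.snd.comp hx))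
      exact this
  refine (Code.eval_part.comp (Computable.const p) Computable.encode).of_eq ?_
  rintro ⟨e, σ, n⟩
  refine eq_evalList_of_fixed (U := U (p, σ)) (fun e n => ?_) e n
  change p.eval (encode (e, σ, n)) = _
  rw [hp]
  simp only [D, ofNat_encode]

end OracleCode

/-! ### Programs for relatively recursive functions -/

theorem some_bind_pfun (x : ℕ) (f : ℕ →. ℕ) : (Part.some x >>= f) = f x := Part.bind_some x f

namespace OracleCode

theorem exists_code_of_recursiveIn {f : ℕ → ℕ} {g : ℕ →. ℕ}
    (hg : Nat.RecursiveIn {(f : ℕ →. ℕ)} g) : ∃ c, eval f c = g := by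
  induction hg with
  | zero => exact ⟨zero, rfl⟩
  | succ => exact ⟨succ, rfl⟩
  | left => exact ⟨left, rfl⟩
  | right => exact ⟨right, rfl⟩
  | oracle g hg => exact ⟨oracle, hg.symm⟩
  | pair _ _ ihf ihg =>
    obtain ⟨cf, rfl⟩ := ihf
    obtain ⟨cg, rfl⟩ := ihg
    exact ⟨pair cf cg, rfl⟩
  | comp _ _ ihf ihg =>
    obtain ⟨cf, rfl⟩ := ihf
    obtain ⟨cg, rfl⟩ := ihg
    exact ⟨comp cf cg, rfl⟩
  | prec _ _ ihf ihg =>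
    obtain ⟨cf, rfl⟩ := ihf
    obtain ⟨cg, rfl⟩ := ihg
    exact ⟨prec cf cg, rfl⟩
  | rfind _ ihf =>
    obtain ⟨cf, rfl⟩ := ihf
    -- `rfind'` starts searching at the second component of its input, so that component is set to
    -- `0`; `pair left right` is the identity.
    refine ⟨comp (rfind' cf) (pair (pair left right) zero), ?_⟩
    funext a
    simp [eval, Seq.seq, Part.map_id', pure, PFun.pure]

/-- A program for the constant function with value `x`. -/
def constCode : ℕ → OracleCode
  | 0 => zero
  | x + 1 => comp succ (constCode x)

theorem eval_constCode (g : ℕ → ℕ) (x n : ℕ) : eval g (constCode x) n = Part.some x := by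
  induction x with
  | zero => rfl
  | succ x ih =>
    simp only [constCode, eval, ih, some_bind_pfun]
    rfl

theorem primrec_encodeCode_constCode : Primrec fun x => encodeCode (constCode x) := by
  refine (Primrec.nat_rec₁ (f := fun _ r => 2 * (2 * Nat.pair 1 r + 1) + 5) 0 ?_).of_eq fun x => ?_
  · exact (Primrec.nat_add.comp (Primrec.nat_double.comp (Primrec.nat_double_succ.comp
      (Primrec₂.natPair.comp (Primrec.const 1) Primrec.snd))) (Primrec.const 5)).to₂
  · induction x with
    | zero => rfl
    | succ x ih => simp only [constCode, encodeCode, ← ih]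

/-- Every partial function computed by an oracle program is approximated, uniformly in the
oracle, by a primitive recursive relation on initial segments of the oracle. -/
theorem exists_primrecPred (c : OracleCode) : ∃ D : List ℕ × ℕ × ℕ → Prop, PrimrecPred D ∧
    ∀ (f : ℕ → ℕ) (n v : ℕ), v ∈ eval f c n ↔ ∃ m, D (initSeg f m, n, v) := by
  have hp : Partrec fun x : List ℕ × ℕ => evalList x.1 c x.2 := by
    have := partrec_evalList.comp ((Computable.const (encodeCode c)).pair Computable.id)
    simpa only [ofNatCode_encodeCode, id] using this
  obtain ⟨p, hp⟩ := Code.exists_code.1 hp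
  have hp' : ∀ (σ : List ℕ) (n v : ℕ), v ∈ evalList σ c n ↔
      ∃ k, v ∈ Code.evaln k p (encode (σ, n)) := fun σ n v => by
    rw [← Code.evaln_complete, hp]
    simp
  -- The length of the segment bounds both the running time and the oracle use `k`. Keeping `k`
  -- separate lets a longer segment grant more steps to a computation with a short use.
  refine ⟨fun x => ∃ k < x.1.length + 1,
    Code.evaln x.1.length p (encode (x.1.take k, x.2.1)) = some x.2.2, ?_, fun f n v => ?_⟩
  · have : PrimrecRel fun (k : ℕ) (x : List ℕ × ℕ × ℕ) =>
        Code.evaln x.1.length p (encode (x.1.take k, x.2.1)) = some x.2.2 := by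
      refine Primrec.eq.comp (Code.primrec_evaln.comp ((Primrec.pair
        (Primrec.list_length.comp (Primrec.fst.comp Primrec.snd)) (Primrec.const p)).pair
          (Primrec.encode.comp (Primrec.pair (Primrec.list_take.comp Primrec.fst
            (Primrec.fst.comp Primrec.snd)) (Primrec.fst.comp (Primrec.snd.comp Primrec.snd))))))
        (Primrec.option_some.comp (Primrec.snd.comp (Primrec.snd.comp Primrec.snd)))
    exact (this.exists_mem_list.comp (Primrec.list_range.comp (Primrec.succ.comp
      (Primrec.list_length.comp Primrec.fst))) Primrec.id).of_eq fun x => by simp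
  · rw [mem_eval_iff]
    constructor
    · rintro ⟨m, hm⟩
      obtain ⟨k, hk⟩ := (hp' _ _ _).1 hm
      refine ⟨max m k, m, by simp, ?_⟩
      rw [take_initSeg f (le_max_left m k), length_initSeg]
      exact Code.evaln_mono (le_max_right m k) hk
    · rintro ⟨m, k, hk, h⟩
      rw [take_initSeg f (by simpa [Nat.lt_succ_iff] using hk)] at h
      exact ⟨k, (hp' _ _ _).2 ⟨_, h⟩⟩

end OracleCode

/-! ### Relative computability and the halting set -/

open OracleCode

/-- The characteristic function of the halting set `∅'`. -/
noncomputable abbrev haltingFn : ℕ → ℕ := charFn (jump (charFn ∅))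

open Classical in
/-- The total function which is `0` where `G` is undefined, and the successor of `G` elsewhere. -/
noncomputable def totalize (G : ℕ →. ℕ) (x : ℕ) : ℕ :=
  if h : (G x).Dom then (G x).get h + 1 else 0

theorem totalize_of_mem {G : ℕ →. ℕ} {x v : ℕ} (h : v ∈ G x) : totalize G x = v + 1 := by
  obtain ⟨h, rfl⟩ := h
  simp [totalize, h]

theorem totalize_eq_zero_iff {G : ℕ →. ℕ} {x : ℕ} : totalize G x = 0 ↔ ¬ (G x).Dom := by
  by_cases h : (G x).Dom <;> simp [totalize, h]

theorem recursiveIn_comp_total {O : Set (ℕ →. ℕ)} {f : ℕ →. ℕ} {g : ℕ → ℕ}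
    (hf : Nat.RecursiveIn O f) (hg : Nat.RecursiveIn O g) :
    Nat.RecursiveIn O fun n => f (g n) :=
  (Nat.RecursiveIn.comp hf hg).of_eq fun n => by simp only [PFun.coe_val, some_bind_pfun]

theorem recursiveIn_comp {O : Set (ℕ →. ℕ)} {f g : ℕ → ℕ} (hf : Nat.RecursiveIn O f)
    (hg : Nat.RecursiveIn O g) : Nat.RecursiveIn O ((fun n => f (g n) : ℕ → ℕ) : ℕ →. ℕ) :=
  recursiveIn_comp_total (f := f) hf hg

theorem recursiveIn_pair {O : Set (ℕ →. ℕ)} {f g : ℕ → ℕ} (hf : Nat.RecursiveIn O f)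
    (hg : Nat.RecursiveIn O g) :
    Nat.RecursiveIn O ((fun n => Nat.pair (f n) (g n) : ℕ → ℕ) : ℕ →. ℕ) :=
  (Nat.RecursiveIn.pair hf hg).of_eq fun n => by simp [Seq.seq]

theorem recursiveIn_of_computable {O : Set (ℕ →. ℕ)} {f : ℕ → ℕ} (hf : Computable f) :
    Nat.RecursiveIn O f :=
  (Partrec.nat_iff.1 hf.partrec).recursiveIn

theorem recursiveIn_nat_rec {O : Set (ℕ →. ℕ)} {a : ℕ} {h : ℕ → ℕ} (hh : Nat.RecursiveIn O h) :
    Nat.RecursiveIn O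
      ((fun n => Nat.rec a (fun y i => h (Nat.pair y i)) n : ℕ → ℕ) : ℕ →. ℕ) := by
  have h1 : Nat.RecursiveIn O ((fun n => h n.unpair.2 : ℕ → ℕ) : ℕ →. ℕ) :=
    recursiveIn_comp hh (recursiveIn_of_computable (Computable.snd.comp Computable.unpair))
  have h0 : Nat.RecursiveIn O ((fun _ => a : ℕ → ℕ) : ℕ →. ℕ) :=
    recursiveIn_of_computable (Computable.const a)
  have hp : Nat.RecursiveIn O ((fun n => Nat.pair 0 n : ℕ → ℕ) : ℕ →. ℕ) :=
    recursiveIn_of_computable (Primrec₂.natPair.comp (Primrec.const 0) Primrec.id).to_comp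
  refine (recursiveIn_comp_total (Nat.RecursiveIn.prec h0 h1) hp).of_eq fun n => ?_
  simp only [PFun.coe_val, Nat.unpair_pair]
  induction n with
  | zero => rfl
  | succ n ih => exact (congrArg (Part.bind · _) ih).trans (Part.bind_some _ _)

theorem recursiveIn_initSeg {O : Set (ℕ →. ℕ)} {f : ℕ → ℕ} (hf : Nat.RecursiveIn O f) :
    Nat.RecursiveIn O ((fun n => encode (initSeg f n) : ℕ → ℕ) : ℕ →. ℕ) := by
  let G : ℕ → ℕ := fun x => encode (ofNat (List ℕ) x.unpair.2 ++ [x.unpair.1])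
  have hG : Primrec G := Primrec.encode.comp (Primrec.list_concat.comp
    ((Primrec.ofNat _).comp (Primrec.snd.comp Primrec.unpair))
    (Primrec.fst.comp Primrec.unpair))
  have h : Nat.RecursiveIn O
      ((fun x => G (Nat.pair (f x.unpair.1) x.unpair.2) : ℕ → ℕ) : ℕ →. ℕ) :=
    recursiveIn_comp (recursiveIn_of_computable hG.to_comp) <| recursiveIn_pair
      (recursiveIn_comp hf (recursiveIn_of_computable (Computable.fst.comp Computable.unpair)))
      (recursiveIn_of_computable (Computable.snd.comp Computable.unpair))
  refine (recursiveIn_nat_rec (a := encode ([] : List ℕ)) h).of_eq fun n => ?_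
  simp only [PFun.coe_val, Nat.unpair_pair, Part.some_inj]
  induction n with
  | zero => rfl
  | succ n ih =>
    change G (Nat.pair (f n) (Nat.rec _ _ n)) = _
    rw [ih]
    simp [G, initSeg, List.range_succ]

/-- The domain of a partial recursive function is decidable relative to the halting set. -/
theorem recursiveIn_totalize {G : ℕ →. ℕ} (hG : Nat.Partrec G) :
    Nat.RecursiveIn {(haltingFn : ℕ →. ℕ)} (totalize G : ℕ →. ℕ) := by
  obtain ⟨c, hc⟩ := exists_code_of_recursiveIn (f := charFn ∅) hG.recursiveIn
  -- The program `q x` ignores its input and runs `c` at `x`; hence it halts on its own number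
  -- exactly when `G x` is defined.
  let q : ℕ → ℕ := fun x => encodeCode (comp c (constCode x))
  have hq : Primrec q :=
    (Primrec.nat_add.comp (Primrec.nat_double.comp (Primrec.nat_double_succ.comp
      (Primrec₂.natPair.comp (Primrec.const (encodeCode c)) primrec_encodeCode_constCode)))
        (Primrec.const 5)).of_eq fun x => rfl
  have hK : ∀ x, haltingFn (q x) = 0 ↔ ¬ (G x).Dom := fun x => by
    have : q x ∈ jump (charFn ∅) ↔ (G x).Dom := by
      simp only [jump, q, ofNatCode_encodeCode, eval, eval_constCode, some_bind_pfun,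
        hc, Set.mem_ofPred_eq]
    rw [← this]
    simp [haltingFn, charFn]
  -- The first component is the answer of the halting set; `G` is run only when it is known to
  -- converge.
  have hP : Nat.Partrec fun y => bif y.unpair.1 == 0 then Part.some 0
      else (G y.unpair.2).map Nat.succ := by
    refine Partrec.nat_iff.1 <| Partrec.cond ?_ (Computable.const 0) ?_
    · exact Primrec.beq.to_comp.comp (Computable.fst.comp Computable.unpair) (Computable.const 0)
    · exact ((Partrec.nat_iff.2 hG).comp (Computable.snd.comp Computable.unpair)).map
        (Computable.succ.comp Computable.snd).to₂
  have hi : Nat.RecursiveIn {(haltingFn : ℕ →. ℕ)}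
      ((fun x => Nat.pair (haltingFn (q x)) x : ℕ → ℕ) : ℕ →. ℕ) :=
    recursiveIn_pair (recursiveIn_comp (Nat.RecursiveIn.oracle _ rfl)
      (recursiveIn_of_computable hq.to_comp)) (recursiveIn_of_computable Computable.id)
  refine (recursiveIn_comp_total hP.recursiveIn hi).of_eq fun x => ?_
  simp only [PFun.coe_val, Nat.unpair_pair]
  by_cases h : (G x).Dom
  · have h0 : (haltingFn (q x) == 0) = false := by
      simpa using fun h' => (hK x).1 h' h
    rw [h0, cond_false]
    obtain ⟨v, hv⟩ := Part.dom_iff_mem.1 h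
    rw [totalize_of_mem hv, Part.eq_some_iff.2 hv, Part.map_some]
  · have h0 : (haltingFn (q x) == 0) = true := by simpa using (hK x).2 h
    rw [h0, cond_true, totalize_eq_zero_iff.2 h]

theorem initSeg_succ {α : Type*} (X : ℕ → α) (m : ℕ) : initSeg X (m + 1) = initSeg X m ++ [X m] := by
  simp [initSeg, List.range_succ]

theorem initSeg_congr {α : Type*} {X Y : ℕ → α} {m : ℕ} (h : ∀ x < m, X x = Y x) :
    initSeg X m = initSeg Y m :=
  List.map_congr_left fun x hx => h x (List.mem_range.1 hx)

/-! ### Primitive recursive predicates -/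

section Primrec

variable {α β γ : Type*} [Primcodable α] [Primcodable β] [Primcodable γ]

theorem primrecPred_exists_mem {l : α → List β} {p : α → β → Prop} (hl : Primrec l)
    (hp : PrimrecPred fun x : α × β => p x.1 x.2) : PrimrecPred fun a => ∃ b ∈ l a, p a b := by
  have : PrimrecRel fun (b : β) (a : α) => p a b := hp.comp (Primrec.snd.pair Primrec.fst)
  exact this.exists_mem_list.comp hl Primrec.id

theorem primrecPred_forall_mem {l : α → List β} {p : α → β → Prop} (hl : Primrec l)
    (hp : PrimrecPred fun x : α × β => p x.1 x.2) : PrimrecPred fun a => ∀ b ∈ l a, p a b := by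
  have : PrimrecRel fun (b : β) (a : α) => p a b := hp.comp (Primrec.snd.pair Primrec.fst)
  exact this.forall_mem_list.comp hl Primrec.id

theorem primrecPred_exists_lt {f : α → ℕ} {p : α → ℕ → Prop} (hf : Primrec f)
    (hp : PrimrecPred fun x : α × ℕ => p x.1 x.2) : PrimrecPred fun a => ∃ k < f a, p a k :=
  (primrecPred_exists_mem (Primrec.list_range.comp hf) hp).of_eq fun a => by simp

theorem primrecPred_exists_le {f : α → ℕ} {p : α → ℕ → Prop} (hf : Primrec f)
    (hp : PrimrecPred fun x : α × ℕ => p x.1 x.2) : PrimrecPred fun a => ∃ k ≤ f a, p a k :=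
  (primrecPred_exists_lt (Primrec.succ.comp hf) hp).of_eq fun a => by simp

theorem primrecPred_forall_lt {f : α → ℕ} {p : α → ℕ → Prop} (hf : Primrec f)
    (hp : PrimrecPred fun x : α × ℕ => p x.1 x.2) : PrimrecPred fun a => ∀ k < f a, p a k :=
  (primrecPred_forall_mem (Primrec.list_range.comp hf) hp).of_eq fun a => by simp

/-- The pairing of two lists, computed entry by entry. -/
def zipList {α β : Type*} (σ : List α) (τ : List β) : List (α × β) :=
  (List.range σ.length).filterMap fun i => σ[i]?.bind fun a => τ[i]?.map fun b => (a, b)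

theorem primrec_zipList : Primrec₂ (zipList (α := α) (β := β)) := by
  refine Primrec.listFilterMap (Primrec.list_range.comp (Primrec.list_length.comp Primrec.fst)) ?_
  refine Primrec.option_bind
    (Primrec.list_getElem?.comp (Primrec.fst.comp Primrec.fst) Primrec.snd) ?_
  refine Primrec.option_map (Primrec.list_getElem?.comp
    (Primrec.snd.comp (Primrec.fst.comp Primrec.fst)) (Primrec.snd.comp Primrec.fst)) ?_
  exact (Primrec.pair (Primrec.snd.comp Primrec.fst) Primrec.snd).to₂

theorem zipList_initSeg {α β : Type*} (X : ℕ → α) (Z : ℕ → β) (m : ℕ) :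
    zipList (initSeg X m) (initSeg Z m) = initSeg (fun n => (X n, Z n)) m := by
  have : ∀ i ∈ List.range m, ((initSeg X m)[i]?.bind fun a => (initSeg Z m)[i]?.map fun b => (a, b))
      = some (X i, Z i) := fun i hi => by
    rw [getElem?_initSeg, getElem?_initSeg, if_pos (List.mem_range.1 hi),
      if_pos (List.mem_range.1 hi)]
    rfl
  rw [zipList, length_initSeg, List.filterMap_congr this, List.filterMap_eq_map']
  rfl

/-- The list of all binary strings of length `m`. -/
def boolStrings (m : ℕ) : List (List Bool) :=
  Nat.rec [[]] (fun _ l => l.map (· ++ [true]) ++ l.map (· ++ [false])) m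

theorem primrec_boolStrings : Primrec boolStrings := by
  have h : ∀ b : Bool, Primrec fun l : List (List Bool) => l.map (· ++ [b]) := fun b =>
    Primrec.list_map Primrec.id (Primrec.list_concat.comp Primrec.snd (Primrec.const b))
  exact Primrec.nat_rec₁ _ (Primrec.list_append.comp ((h true).comp Primrec.snd)
    ((h false).comp Primrec.snd))

theorem mem_boolStrings {m : ℕ} {τ : List Bool} :
    τ ∈ boolStrings m ↔ ∃ Z : ℕ → Bool, initSeg Z m = τ := by
  induction m generalizing τ with
  | zero => simp [boolStrings, initSeg, eq_comm]
  | succ m ih =>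
    change τ ∈ (boolStrings m).map _ ++ (boolStrings m).map _ ↔ _
    simp only [List.mem_append, List.mem_map, ih]
    constructor
    · have (b : Bool) (Z : ℕ → Bool) : initSeg (fun n => if n < m then Z n else b) (m + 1) =
          initSeg Z m ++ [b] := by
        rw [initSeg_succ, if_neg (lt_irrefl m), initSeg_congr fun x hx => if_pos hx]
      rintro (⟨_, ⟨Z, rfl⟩, rfl⟩ | ⟨_, ⟨Z, rfl⟩, rfl⟩)
      · exact ⟨_, this true Z⟩
      · exact ⟨_, this false Z⟩
    · rintro ⟨Z, rfl⟩
      rw [initSeg_succ]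
      cases Z m
      · exact .inr ⟨_, ⟨Z, rfl⟩, rfl⟩
      · exact .inl ⟨_, ⟨Z, rfl⟩, rfl⟩

/-- There are only countably many programs. This lets the forcing arguments meet all requirements in
a sequence of stages; the enumeration need not be effective. -/
theorem countable_primrecPred : {D : α → Prop | PrimrecPred D}.Countable := by
  refine (Set.countable_range fun (c : Code) (a : α) => 1 ∈ c.eval (encode a)).mono ?_
  rintro D ⟨_, hD⟩
  obtain ⟨c, hc⟩ := Code.exists_code.1 hD.to_comp
  refine ⟨c, funext fun a => propext ?_⟩
  change 1 ∈ c.eval (encode a) ↔ D a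
  rw [hc]
  by_cases h : D a <;> simp [h]

theorem exists_enum_primrecPred (α : Type*) [Primcodable α] : ∃ E : ℕ → α → Prop,
    (∀ i, PrimrecPred (E i)) ∧ ∀ D, PrimrecPred D → ∃ i, E i = D := by
  obtain ⟨E, hE⟩ := countable_primrecPred.exists_eq_range
    (⟨fun _ => True, ⟨inferInstance, Primrec.const true⟩⟩ : {D : α → Prop | PrimrecPred D}.Nonempty)
  exact ⟨E, fun i => hE.symm.subset ⟨i, rfl⟩, fun D hD => hE.subset hD⟩

end Primrec

/-! ### Compactness of Cantor space -/

theorem isClosed_setOf_initSeg (p : List Bool → Prop) (m : ℕ) :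
    IsClosed {Z : ℕ → Bool | p (initSeg Z m)} := by
  have hc : Continuous fun (Z : ℕ → Bool) (i : Fin m) => Z i := by fun_prop
  convert (isClosed_discrete {w : Fin m → Bool | p (List.ofFn w)}).preimage hc using 1
  ext Z
  have : initSeg Z m = List.ofFn fun i : Fin m => Z i := by
    apply List.ext_getElem <;> simp [initSeg]
  simp [this]

theorem exists_forall_of_antitone (C : ℕ → Set (ℕ → Bool)) (hC : ∀ m, IsClosed (C m))
    (hanti : ∀ m, C (m + 1) ⊆ C m) (hne : ∀ m, (C m).Nonempty) : ∃ Z, ∀ m, Z ∈ C m := by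
  obtain ⟨Z, hZ⟩ := IsCompact.nonempty_iInter_of_sequence_nonempty_isCompact_isClosed C hanti hne
    (hC 0).isCompact hC
  exact ⟨Z, Set.mem_iInter.1 hZ⟩

/-! ### Relative hyperimmunity -/

section Hyperimmune

variable {α β : Type} [Primcodable α] [Primcodable β] {B : Set ℕ}

/-- The requirement that the enumeration operator `D`, applied to `Y`, does not produce for
every `n` only bounds `v` for an element of `B` in `[n, v]`. -/
def Evades (B : Set ℕ) (D : List α × ℕ × ℕ → Prop) (Y : ℕ → α) : Prop :=
  (∀ n, ∃ v m, D (initSeg Y m, n, v)) →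
    ∃ n v m, D (initSeg Y m, n, v) ∧ Disjoint B (Set.Icc n v)

/-- `B` is hyperimmune relative to `X`: no function computed by `X` gives for every `n` a bound
for an element of `B` that is at least `n`. -/
def HyperimmuneIn (B : Set ℕ) (X : ℕ → α) : Prop :=
  ∀ D : List α × ℕ × ℕ → Prop, PrimrecPred D → Evades B D X

theorem HyperimmuneIn.of_primrec {X : ℕ → α} (hX : HyperimmuneIn B X) {Y : ℕ → β}
    {Φ : List α → List β} (hΦ : Primrec Φ) (hY : ∀ m, Φ (initSeg X m) = initSeg Y m) :
    HyperimmuneIn B Y := by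
  intro D hD
  have := hX (fun x => D (Φ x.1, x.2)) (hD.comp ((hΦ.comp Primrec.fst).pair Primrec.snd))
  simpa only [Evades, hY] using this

theorem HyperimmuneIn.map {X : ℕ → α} (hX : HyperimmuneIn B X) {φ : α → β} (hφ : Primrec φ) :
    HyperimmuneIn B fun n => φ (X n) :=
  hX.of_primrec (Φ := List.map φ) (Primrec.list_map Primrec.id (hφ.comp Primrec.snd).to₂)
    fun m => by simp [initSeg]

/-- A uniform query is either answered positively for all `Z` at an interval that misses `B`,
or negatively at some `n` for some `Z`. -/
theorem HyperimmuneIn.query {X : ℕ → α} (hX : HyperimmuneIn B X)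
    {K : List α → List Bool → ℕ → ℕ → Prop}
    (hK : PrimrecPred fun x : (List α × List Bool) × ℕ × ℕ => K x.1.1 x.1.2 x.2.1 x.2.2)
    (hmono : ∀ Z n m, K (initSeg X m) (initSeg Z m) n m →
      K (initSeg X (m + 1)) (initSeg Z (m + 1)) n (m + 1)) :
    (∃ n b m, Disjoint B (Set.Icc n b) ∧ ∀ Z, K (initSeg X m) (initSeg Z m) n b) ∨
      ∃ n Z, ∀ m, ¬ K (initSeg X m) (initSeg Z m) n m := by
  -- `W` is itself an operator on `X` that proposes bounds. If it proposes one for every `n`,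
  -- hyperimmunity gives a proposed interval missing `B`; if it fails at some `n`, compactness
  -- yields a single `Z` that is never answered.
  let W : List α × ℕ × ℕ → Prop := fun x => ∀ τ ∈ boolStrings x.1.length, K x.1 τ x.2.1 x.2.2
  have hW : PrimrecPred W := by
    refine primrecPred_forall_mem (primrec_boolStrings.comp
      (Primrec.list_length.comp Primrec.fst)) ?_
    exact hK.comp (((Primrec.fst.comp Primrec.fst).pair Primrec.snd).pair
      (Primrec.snd.comp Primrec.fst))
  have hW' : ∀ m n b, W (initSeg X m, n, b) ↔ ∀ Z, K (initSeg X m) (initSeg Z m) n b := by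
    intro m n b
    simp only [W, length_initSeg, mem_boolStrings]
    exact ⟨fun h Z => h _ ⟨Z, rfl⟩, by rintro h _ ⟨Z, rfl⟩; exact h Z⟩
  by_cases h : ∀ n, ∃ b m, W (initSeg X m, n, b)
  · obtain ⟨n, b, m, hm, hd⟩ := hX W hW h
    exact .inl ⟨n, b, m, hd, (hW' _ _ _).1 hm⟩
  · push Not at h
    obtain ⟨n, hn⟩ := h
    -- Taking the bound equal to the length `m` exhausts all bounds, and `hmono` makes the classes
    -- of unanswered `Z` decreasing.
    obtain ⟨Z, hZ⟩ := exists_forall_of_antitone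
      (fun m => {Z | ¬ K (initSeg X m) (initSeg Z m) n m})
      (fun m => isClosed_setOf_initSeg (fun τ => ¬ K (initSeg X m) τ n m) m)
      (fun m Z hZ hK => hZ (hmono Z n m hK))
      (fun m => by simpa [hW', Set.Nonempty] using hn m m)
    exact .inr ⟨n, Z, hZ⟩

/-- A basis theorem: a nonempty `Π⁰₁(X)` class in Cantor space has a member that, together with
`X`, preserves the hyperimmunity of `B`. -/
theorem HyperimmuneIn.exists_mem_class {X : ℕ → α} (hX : HyperimmuneIn B X)
    {D : List α × List Bool → Prop} (hD : PrimrecPred D)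
    (hne : ∃ Z : ℕ → Bool, ∀ m, ¬ D (initSeg X m, initSeg Z m)) :
    ∃ Z : ℕ → Bool, (∀ m, ¬ D (initSeg X m, initSeg Z m)) ∧
      HyperimmuneIn B fun n => (X n, Z n) := by
  -- The forcing conditions are the nonempty `Π⁰₁(X)` classes `P D`, shrunk once for each
  -- requirement.
  let P : (List α × List Bool → Prop) → Set (ℕ → Bool) :=
    fun D => {Z | ∀ m, ¬ D (initSeg X m, initSeg Z m)}
  let S := {D : List α × List Bool → Prop // PrimrecPred D ∧ (P D).Nonempty}
  have step : ∀ (D : S) (E : List (α × Bool) × ℕ × ℕ → Prop), PrimrecPred E →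
      ∃ D' : S, P D'.1 ⊆ P D.1 ∧ ∀ Z ∈ P D'.1, Evades B E fun n => (X n, Z n) := by
    rintro ⟨D, hD, hne⟩ E hE
    -- The query asks whether `Z` has visibly left the class or `E` has produced a value `≤ b` at
    -- `n`.
    let K : List α → List Bool → ℕ → ℕ → Prop := fun σ τ n b => ∃ k ≤ σ.length,
      D (σ.take k, τ.take k) ∨ ∃ v ≤ b, E (zipList (σ.take k) (τ.take k), n, v)
    have hK : PrimrecPred fun x : (List α × List Bool) × ℕ × ℕ => K x.1.1 x.1.2 x.2.1 x.2.2 := by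
      have h1 : Primrec fun x : ((List α × List Bool) × ℕ × ℕ) × ℕ => x.1.1.1.take x.2 :=
        Primrec.list_take.comp Primrec.snd
          (Primrec.fst.comp (Primrec.fst.comp (Primrec.fst)))
      have h2 : Primrec fun x : ((List α × List Bool) × ℕ × ℕ) × ℕ => x.1.1.2.take x.2 :=
        Primrec.list_take.comp Primrec.snd
          (Primrec.snd.comp (Primrec.fst.comp (Primrec.fst)))
      refine primrecPred_exists_le
        (Primrec.list_length.comp (Primrec.fst.comp Primrec.fst)) (.or (hD.comp (h1.pair h2)) ?_)
      refine primrecPred_exists_le (Primrec.snd.comp (Primrec.snd.comp Primrec.fst)) ?_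
      exact hE.comp ((primrec_zipList.comp (h1.comp Primrec.fst) (h2.comp Primrec.fst)).pair
        ((Primrec.fst.comp (Primrec.snd.comp (Primrec.fst.comp Primrec.fst))).pair Primrec.snd))
    have hK' : ∀ Z n m b, K (initSeg X m) (initSeg Z m) n b ↔ ∃ k ≤ m,
        D (initSeg X k, initSeg Z k) ∨ ∃ v ≤ b, E (initSeg (fun n => (X n, Z n)) k, n, v) := by
      intro Z n m b
      simp only [K, length_initSeg]
      refine exists_congr fun k => and_congr_right fun hk => ?_
      rw [take_initSeg X hk, take_initSeg Z hk, zipList_initSeg]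
    rcases hX.query hK (fun Z n m h => by
        rw [hK'] at h ⊢
        obtain ⟨k, hk, h⟩ := h
        exact ⟨k, hk.trans m.le_succ, h.imp id fun ⟨v, hv, h⟩ => ⟨v, hv.trans m.le_succ, h⟩⟩) with
      ⟨n, b, m, hd, h⟩ | ⟨n, Z, hZ⟩
    · refine ⟨⟨D, hD, hne⟩, subset_rfl, fun Z hZ _ => ?_⟩
      obtain ⟨k, -, hk | ⟨v, hv, hk⟩⟩ := (hK' _ _ _ _).1 (h Z)
      · exact absurd hk (hZ k)
      · exact ⟨n, v, k, hk, hd.mono_right (Set.Icc_subset_Icc_right hv)⟩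
    -- Negative answer: restrict to the members on which `E` never produces a value at `n`; the
    -- requirement then holds vacuously.
    · refine ⟨⟨fun x => K x.1 x.2 n x.1.length, ?_, Z, fun m => ?_⟩, fun Z hZ m h => ?_,
        fun Z hZ h => ?_⟩
      · exact hK.comp (Primrec.id.pair ((Primrec.const n).pair
          (Primrec.list_length.comp Primrec.fst)))
      · simpa using hZ m
      · exact hZ m (by simpa using (hK' Z n m m).2 ⟨m, le_rfl, .inl h⟩)
      · obtain ⟨v, m, h⟩ := h n
        refine absurd ?_ (hZ (max m v))
        simpa using (hK' Z n _ _).2 ⟨m, le_max_left m v, .inr ⟨v, le_max_right m v, h⟩⟩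
  obtain ⟨E, hE, hE'⟩ := exists_enum_primrecPred (List (α × Bool) × ℕ × ℕ)
  choose next hsub hnext using fun (D : S) i => step D (E i) (hE i)
  let a : ℕ → S := fun i => Nat.rec ⟨D, hD, hne⟩ (fun i D => next D i) i
  obtain ⟨Z, hZ⟩ := exists_forall_of_antitone (fun i => P (a i).1)
    (fun i => by
      have : P (a i).1 = ⋂ m, {Z | ¬ (a i).1 (initSeg X m, initSeg Z m)} := by
        ext; simp [P]
      rw [this]
      exact isClosed_iInter fun m =>
        isClosed_setOf_initSeg (fun τ => ¬ (a i).1 (initSeg X m, τ)) m)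
    (fun i => hsub (a i) i) (fun i => (a i).2.2)
  refine ⟨Z, hZ 0, fun D hD => ?_⟩
  obtain ⟨i, rfl⟩ := hE' D hD
  exact hnext (a i) i Z (hZ (i + 1))

/-! ### Preservation of hyperimmunity by the infinite pigeonhole principle -/

theorem HyperimmuneIn.removeInitial {X : ℕ → Bool} (hX : HyperimmuneIn B X) (N : ℕ) :
    HyperimmuneIn B fun n => decide (N ≤ n) && X n := by
  refine hX.of_primrec (Φ := fun σ => (List.range σ.length).map fun i =>
    decide (N ≤ i) && σ.getD i false) ?_ fun m => ?_
  · refine Primrec.list_map (Primrec.list_range.comp Primrec.list_length) ?_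
    exact Primrec.and.comp (Primrec.nat_le.decide.comp (Primrec.const N) Primrec.snd)
      ((Primrec.list_getD false).comp Primrec.fst Primrec.snd)
  · rw [length_initSeg]
    refine List.map_congr_left fun i hi => ?_
    rw [List.getD_eq_getElem?_getD, getElem?_initSeg, if_pos (List.mem_range.1 hi)]
    rfl

/-- A condition of the forcing: initial segments of length `len` of two sets, one inside `A` and
one outside, and a reservoir. -/
structure PigeonholeCondition (B : Set ℕ) (X A : ℕ → Bool) where
  /-- The two sets whose initial segments are decided. -/
  stem : Bool → ℕ → Bool
  /-- The length of the initial segments. -/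
  len : ℕ
  /-- The reservoir. -/
  reservoir : ℕ → Bool
  reservoir_hyperimmune : HyperimmuneIn B reservoir
  reservoir_infinite : {x | reservoir x = true}.Infinite
  reservoir_le : ∀ x, reservoir x = true → X x = true
  stem_le : ∀ i, ∀ x < len, stem i x = true → X x = true ∧ A x = i

namespace PigeonholeCondition

variable {X A : ℕ → Bool}

/-- `c.Allows i Y`: the set `Y` is compatible with the condition `c` on side `i`. -/
def Allows (c : PigeonholeCondition B X A) (i : Bool) (Y : ℕ → Bool) : Prop :=
  (∀ x < c.len, Y x = c.stem i x) ∧ ∀ x, c.len ≤ x → Y x = true → c.reservoir x = true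

/-- The condition `d` extends the condition `c`. -/
structure Extends (d c : PigeonholeCondition B X A) : Prop where
  len_le : c.len ≤ d.len
  stem_allows : ∀ i, ∀ x < d.len,
    if x < c.len then d.stem i x = c.stem i x else d.stem i x = true → c.reservoir x = true
  reservoir_le : ∀ x, d.reservoir x = true → c.reservoir x = true

theorem Extends.refl (c : PigeonholeCondition B X A) : c.Extends c :=
  ⟨le_rfl, fun i x hx => by simp [hx], fun _ h => h⟩

theorem Extends.allows {c d : PigeonholeCondition B X A} (h : d.Extends c) {i : Bool}
    {Y : ℕ → Bool} (hY : d.Allows i Y) : c.Allows i Y := by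
  refine ⟨fun x hx => ?_, fun x hx hYx => ?_⟩
  · have := h.stem_allows i x (hx.trans_le h.len_le)
    rw [if_pos hx] at this
    rw [hY.1 x (hx.trans_le h.len_le), this]
  · by_cases hx' : x < d.len
    · have := h.stem_allows i x hx'
      rw [if_neg hx.not_gt] at this
      exact this (hY.1 x hx' ▸ hYx)
    · exact h.reservoir_le x (hY.2 x (not_lt.1 hx') hYx)

theorem Extends.trans {c d e : PigeonholeCondition B X A} (h : e.Extends d) (h' : d.Extends c) :
    e.Extends c := by
  refine ⟨h'.len_le.trans h.len_le, fun i x hx => ?_, fun x hx => h'.reservoir_le x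
    (h.reservoir_le x hx)⟩
  have h1 := h.stem_allows i x hx
  split_ifs with hxc
  · rw [if_pos (hxc.trans_le h'.len_le)] at h1
    have h2 := h'.stem_allows i x (hxc.trans_le h'.len_le)
    rw [if_pos hxc] at h2
    exact h1.trans h2
  · intro hex
    by_cases hxd : x < d.len
    · rw [if_pos hxd] at h1
      have h2 := h'.stem_allows i x hxd
      rw [if_neg hxc] at h2
      exact h2 (h1 ▸ hex)
    · rw [if_neg hxd] at h1
      exact h'.reservoir_le x (h1 hex)

/-- `c` decides longer initial segments by those of `Y` on side `i`, and by nothing on the other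
side. -/
def extendStem (c : PigeonholeCondition B X A) (i : Bool) (Y : ℕ → Bool) (k : ℕ)
    (hY : ∀ x, c.len ≤ x → x < k → Y x = true → c.reservoir x = true ∧ A x = i) :
    PigeonholeCondition B X A where
  stem j x := if x < c.len then c.stem j x else decide (x < k) && decide (j = i) && Y x
  len := max c.len k
  reservoir := c.reservoir
  reservoir_hyperimmune := c.reservoir_hyperimmune
  reservoir_infinite := c.reservoir_infinite
  reservoir_le := c.reservoir_le
  stem_le j x hx h := by
    split_ifs at h with hxc
    · exact c.stem_le j x hxc h
    · simp only [Bool.and_eq_true, decide_eq_true_iff] at h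
      obtain ⟨⟨hk, rfl⟩, hYx⟩ := h
      have := hY x (not_lt.1 hxc) hk hYx
      exact ⟨c.reservoir_le x this.1, this.2⟩

theorem extends_extendStem (c : PigeonholeCondition B X A) (i : Bool) (Y : ℕ → Bool) (k : ℕ)
    (hY : ∀ x, c.len ≤ x → x < k → Y x = true → c.reservoir x = true ∧ A x = i) :
    (c.extendStem i Y k hY).Extends c := by
  refine ⟨le_max_left _ _, fun j x hx => ?_, fun _ h => h⟩
  simp only [extendStem]
  split_ifs with hxc
  · rfl
  · simp only [Bool.and_eq_true, decide_eq_true_iff]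
    exact fun ⟨⟨hk, _⟩, hYx⟩ => (hY x (not_lt.1 hxc) hk hYx).1

theorem exists_mem (c : PigeonholeCondition B X A) (i : Bool)
    (h : ∃ x, c.len ≤ x ∧ c.reservoir x = true ∧ A x = i) :
    ∃ d : PigeonholeCondition B X A, d.Extends c ∧ ∃ x, c.len ≤ x ∧ x < d.len ∧
      d.stem i x = true := by
  obtain ⟨x, hx, hR, hA⟩ := h
  refine ⟨c.extendStem i (fun y => decide (y = x)) (x + 1) ?_, c.extends_extendStem _ _ _ _,
    x, hx, by simp [extendStem], by simp [extendStem, hx.not_gt]⟩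
  intro y _ _ hy
  obtain rfl := of_decide_eq_true hy
  exact ⟨hR, hA⟩

/-- The query whether a finite set allowed by `c` on side `i`, its new part being inside the
reservoir `σ` and on side `i` of the partition `τ`, produces a bound `≤ b`. -/
def Query (c : PigeonholeCondition B X A) (i : Bool) (D : List Bool × ℕ × ℕ → Prop)
    (σ τ : List Bool) (n b : ℕ) : Prop :=
  ∃ k ≤ σ.length, ∃ η ∈ boolStrings k,
    (∀ x < k, (x < c.len ∧ η[x]? = (initSeg (c.stem i) c.len)[x]?) ∨
      (c.len ≤ x ∧ (¬ η[x]? = some true ∨ (σ[x]? = some true ∧ τ[x]? = some i)))) ∧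
    ∃ v ≤ b, D (η, n, v)

theorem primrecPred_query (c : PigeonholeCondition B X A) (i : Bool)
    {D : List Bool × ℕ × ℕ → Prop} (hD : PrimrecPred D) :
    PrimrecPred fun x : (List Bool × List Bool) × ℕ × ℕ =>
      c.Query i D x.1.1 x.1.2 x.2.1 x.2.2 := by
  refine primrecPred_exists_le
    (Primrec.list_length.comp (Primrec.fst.comp Primrec.fst)) ?_
  refine primrecPred_exists_mem (primrec_boolStrings.comp Primrec.snd) (.and ?_ ?_)
  · refine primrecPred_forall_lt (Primrec.snd.comp Primrec.fst) ?_
    have hη := Primrec.list_getElem?.comp (α := ((((List Bool × List Bool) × ℕ × ℕ) × ℕ) ×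
      List Bool) × ℕ) (Primrec.snd.comp Primrec.fst) Primrec.snd
    have hσ := Primrec.list_getElem?.comp (α := ((((List Bool × List Bool) × ℕ × ℕ) × ℕ) ×
      List Bool) × ℕ) (Primrec.fst.comp (Primrec.fst.comp (Primrec.fst.comp (Primrec.fst.comp
        Primrec.fst)))) Primrec.snd
    have hτ := Primrec.list_getElem?.comp (α := ((((List Bool × List Bool) × ℕ × ℕ) × ℕ) ×
      List Bool) × ℕ) (Primrec.snd.comp (Primrec.fst.comp (Primrec.fst.comp (Primrec.fst.comp
        Primrec.fst)))) Primrec.snd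
    refine .or (.and (Primrec.nat_lt.comp Primrec.snd (Primrec.const _)) (Primrec.eq.comp hη
      (Primrec.list_getElem?.comp (Primrec.const _) Primrec.snd)))
      (.and (Primrec.nat_le.comp (Primrec.const _) Primrec.snd) (.or (.not ?_) (.and ?_ ?_)))
    · exact Primrec.eq.comp hη (Primrec.const _)
    · exact Primrec.eq.comp hσ (Primrec.const _)
    · exact Primrec.eq.comp hτ (Primrec.const _)
  · refine primrecPred_exists_le (Primrec.snd.comp (Primrec.snd.comp
      (Primrec.fst.comp Primrec.fst))) ?_
    exact hD.comp ((Primrec.snd.comp Primrec.fst).pair (Primrec.pair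
      (Primrec.fst.comp (Primrec.snd.comp (Primrec.fst.comp (Primrec.fst.comp Primrec.fst))))
        Primrec.snd))

theorem query_iff (c : PigeonholeCondition B X A) (i : Bool) {D : List Bool × ℕ × ℕ → Prop}
    {R Z : ℕ → Bool} {m n b : ℕ} :
    c.Query i D (initSeg R m) (initSeg Z m) n b ↔ ∃ k ≤ m, ∃ Y : ℕ → Bool,
      (∀ x < k, (x < c.len ∧ Y x = c.stem i x) ∨
        (c.len ≤ x ∧ (Y x = true → R x = true ∧ Z x = i))) ∧
      ∃ v ≤ b, D (initSeg Y k, n, v) := by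
  simp only [Query, length_initSeg, mem_boolStrings]
  refine exists_congr fun k => and_congr_right fun hk => ?_
  have key : ∀ Y : ℕ → Bool, (∀ x < k,
      (x < c.len ∧ (initSeg Y k)[x]? = (initSeg (c.stem i) c.len)[x]?) ∨
      (c.len ≤ x ∧ (¬ (initSeg Y k)[x]? = some true ∨
        ((initSeg R m)[x]? = some true ∧ (initSeg Z m)[x]? = some i)))) ↔
      ∀ x < k, (x < c.len ∧ Y x = c.stem i x) ∨
        (c.len ≤ x ∧ (Y x = true → R x = true ∧ Z x = i)) := by
    refine fun Y => forall₂_congr fun x hx => or_congr (and_congr_right fun hxc => ?_)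
      (and_congr_right fun _ => ?_)
    · simp only [getElem?_initSeg, hx, hxc, if_true, Option.some_inj]
    · simp only [getElem?_initSeg, hx, hx.trans_le hk, if_true, Option.some_inj, imp_iff_not_or]
  constructor
  · rintro ⟨_, ⟨Y, rfl⟩, h1, h2⟩
    exact ⟨Y, (key Y).1 h1, h2⟩
  · rintro ⟨Y, h1, h2⟩
    exact ⟨_, ⟨Y, rfl⟩, (key Y).2 h1, h2⟩

/-- Every condition has an extension that forces one of two given requirements, one for each
side. -/
theorem exists_forces (c : PigeonholeCondition B X A) {D : Bool → List Bool × ℕ × ℕ → Prop}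
    (hD : ∀ i, PrimrecPred (D i)) :
    ∃ d : PigeonholeCondition B X A, d.Extends c ∧ ∃ i, ∀ Y, d.Allows i Y → Evades B (D i) Y := by
  -- The query runs over all partitions `τ` instead of the given `A`, so it is a question about the
  -- reservoir, whose hyperimmunity property applies.
  let K : List Bool → List Bool → ℕ → ℕ → Prop := fun σ τ n b =>
    c.Query false (D false) σ τ n b ∨ c.Query true (D true) σ τ n b
  have hK : PrimrecPred fun x : (List Bool × List Bool) × ℕ × ℕ => K x.1.1 x.1.2 x.2.1 x.2.2 :=
    (c.primrecPred_query false (hD false)).or (c.primrecPred_query true (hD true))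
  have hK' : ∀ {R Z : ℕ → Bool} {m n b : ℕ}, K (initSeg R m) (initSeg Z m) n b ↔
      ∃ i, ∃ k ≤ m, ∃ Y : ℕ → Bool,
      (∀ x < k, (x < c.len ∧ Y x = c.stem i x) ∨
        (c.len ≤ x ∧ (Y x = true → R x = true ∧ Z x = i))) ∧
      ∃ v ≤ b, D i (initSeg Y k, n, v) := by
    intros
    simp only [K, query_iff, Bool.exists_bool]
  rcases c.reservoir_hyperimmune.query hK fun Z n m h => by
      rw [hK'] at h ⊢
      obtain ⟨i, k, hk, Y, hY, v, hv, h⟩ := h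
      exact ⟨i, k, hk.trans m.le_succ, Y, hY, v, hv.trans m.le_succ, h⟩ with
    ⟨n, b, m, hd, h⟩ | ⟨n, Z, hZ⟩
  -- Positive answer: specialized to the true partition `A`, it gives a finite extension on one side
  -- whose bound leaves an interval missing `B`.
  · obtain ⟨i, k, -, Y, hY, v, hv, h⟩ := hK'.1 (h A)
    have hYk : ∀ x, c.len ≤ x → x < k → Y x = true → c.reservoir x = true ∧ A x = i :=
      fun x hx hxk => ((hY x hxk).resolve_left fun h => hx.not_gt h.1).2
    refine ⟨c.extendStem i Y k hYk, c.extends_extendStem _ _ _ _, i, fun Y' hY' _ => ?_⟩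
    refine ⟨n, v, k, ?_, hd.mono_right (Set.Icc_subset_Icc_right hv)⟩
    rwa [initSeg_congr (Y := Y) fun x hx => ?_]
    rw [hY'.1 x (hx.trans_le (le_max_right _ _))]
    simp only [extendStem]
    split_ifs with hxc
    · exact (((hY x hx).resolve_right fun h => h.1.not_gt hxc).2).symm
    · simp [hx]
  -- Negative answer: some partition `Z` blocks both operators at `n`, and it can be chosen to
  -- preserve hyperimmunity. Thinning the reservoir to an infinite half under `Z` keeps the operator
  -- of that side undefined at `n`.
  · obtain ⟨Z, hZ, hRZ⟩ := c.reservoir_hyperimmune.exists_mem_class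
      (D := fun x => K x.1 x.2 n x.1.length)
      (hK.comp (Primrec.id.pair ((Primrec.const n).pair
        (Primrec.list_length.comp Primrec.fst)))) ⟨Z, fun m => by simpa using hZ m⟩
    obtain ⟨i, hi⟩ : ∃ i, {x | (c.reservoir x && Z x == i) = true}.Infinite := by
      by_contra! hcon
      refine c.reservoir_infinite (((hcon true).union (hcon false)).subset fun x hx => ?_)
      cases hZx : Z x <;> simp_all
    refine ⟨⟨c.stem, c.len, fun x => c.reservoir x && Z x == i, ?_, hi,
      fun x hx => c.reservoir_le x ?_, c.stem_le⟩, ⟨le_rfl, fun j x hx => ?_, fun x hx => ?_⟩,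
      i, fun Y hY h => ?_⟩
    · exact hRZ.map (φ := fun p : Bool × Bool => p.1 && p.2 == i)
        (Primrec.and.comp Primrec.fst (Primrec.beq.comp Primrec.snd (Primrec.const i)))
    · exact (Bool.and_eq_true _ _ ▸ hx).1
    · exact (if_pos hx).symm ▸ rfl
    · exact (Bool.and_eq_true _ _ ▸ hx).1
    · obtain ⟨v, m, h⟩ := h n
      refine absurd (hK'.2 ⟨i, m, le_max_left m v, Y, fun x _ => ?_, v, le_max_right m v, h⟩)
        (by simpa using hZ (max m v))
      rcases lt_or_ge x c.len with hx | hx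
      · exact .inl ⟨hx, hY.1 x hx⟩
      · refine .inr ⟨hx, fun hYx => ?_⟩
        simpa using hY.2 x hx hYx

end PigeonholeCondition

open PigeonholeCondition in
/-- The pigeonhole principle for two colors strongly preserves hyperimmunity. -/
theorem HyperimmuneIn.exists_subset_or_disjoint {X : ℕ → Bool} (hX : HyperimmuneIn B X)
    (hinf : {x | X x = true}.Infinite) (A : ℕ → Bool) :
    ∃ L : ℕ → Bool, HyperimmuneIn B L ∧ {x | L x = true}.Infinite ∧
      ∃ i, ∀ x, L x = true → X x = true ∧ A x = i := by
  by_cases hred : ∃ R : ℕ → Bool, HyperimmuneIn B R ∧ {x | R x = true}.Infinite ∧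
      (∀ x, R x = true → X x = true) ∧ ∃ i N, ∀ x, N ≤ x → R x = true → A x = i
  -- If some reservoir lies almost entirely on one side, its tail is already a solution. Otherwise
  -- every reservoir meets both sides arbitrarily far out, so both sets can be made infinite.
  · obtain ⟨R, hR, hRinf, hRX, i, N, h⟩ := hred
    refine ⟨_, hR.removeInitial N, ?_, i, fun x hx => ?_⟩
    · refine (hRinf.sdiff (Set.finite_lt_nat N)).mono fun x hx => ?_
      simpa [and_comm] using hx
    · simp only [Bool.and_eq_true, decide_eq_true_iff] at hx
      exact ⟨hRX x hx.2, h x hx.1 hx.2⟩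
  have hboth : ∀ (c : PigeonholeCondition B X A) i,
      ∃ x, c.len ≤ x ∧ c.reservoir x = true ∧ A x = i := by
    intro c i
    by_contra! hcon
    refine hred ⟨c.reservoir, c.reservoir_hyperimmune, c.reservoir_infinite, c.reservoir_le,
      !i, c.len, fun x hx hR => ?_⟩
    have := hcon x hx hR
    cases i <;> simpa using this
  obtain ⟨E, hE, hE'⟩ := exists_enum_primrecPred (List Bool × ℕ × ℕ)
  -- Stage `s` treats a pair of requirements, one per side, and every pair has its stage.
  let D (s : ℕ) (i : Bool) : List Bool × ℕ × ℕ → Prop := E (bif i then s.unpair.1 else s.unpair.2)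
  have step : ∀ (c : PigeonholeCondition B X A) (s : ℕ), ∃ d : PigeonholeCondition B X A,
      d.Extends c ∧ (∀ i, ∃ x, c.len ≤ x ∧ x < d.len ∧ d.stem i x = true) ∧
      ∃ i, ∀ Y, d.Allows i Y → Evades B (D s i) Y := by
    intro c s
    obtain ⟨d, hdc, i, hi⟩ := c.exists_forces (D := D s) fun i => hE _
    obtain ⟨e, hed, x, hx, hxe, hex⟩ := d.exists_mem true (hboth d true)
    obtain ⟨f, hfe, y, hy, hyf, hfy⟩ := e.exists_mem false (hboth e false)
    refine ⟨f, (hfe.trans hed).trans hdc, fun j => ?_, i, fun Y hY =>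
      hi Y (hed.allows (hfe.allows hY))⟩
    cases j
    · exact ⟨y, (hdc.len_le.trans hed.len_le).trans hy, hyf, hfy⟩
    · refine ⟨x, hdc.len_le.trans hx, hxe.trans_le hfe.len_le, ?_⟩
      have := hfe.stem_allows true x (hxe.trans_le hfe.len_le)
      rw [if_pos hxe] at this
      rw [this, hex]
  choose next hnext hmem hforce using step
  let c : ℕ → PigeonholeCondition B X A := fun s =>
    Nat.rec ⟨fun _ _ => false, 0, X, hX, hinf, fun _ h => h, by simp⟩ (fun s d => next d s) s
  have hext : ∀ s t, s ≤ t → (c t).Extends (c s) := by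
    intro s t hst
    induction t, hst using Nat.le_induction with
    | base => exact .refl _
    | succ t _ ih => exact (hnext (c t) t).trans ih
  have hlen : ∀ s, s ≤ (c s).len := by
    intro s
    induction s with
    | zero => exact Nat.zero_le _
    | succ s ih =>
      obtain ⟨x, hx, hx', -⟩ := hmem (c s) s true
      change s + 1 ≤ (next (c s) s).len
      omega
  let L : Bool → ℕ → Bool := fun i x => (c (x + 1)).stem i x
  have hL : ∀ i s, ∀ x < (c s).len, L i x = (c s).stem i x := by
    intro i s x hx
    have hx' : x < (c (x + 1)).len := hlen (x + 1)
    have h1 := (hext s _ (le_max_left s (x + 1))).stem_allows i x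
      (hx.trans_le (hext s _ (le_max_left s (x + 1))).len_le)
    have h2 := (hext (x + 1) _ (le_max_right s (x + 1))).stem_allows i x
      (hx.trans_le (hext s _ (le_max_left s (x + 1))).len_le)
    rw [if_pos hx] at h1
    rw [if_pos hx'] at h2
    exact h2.symm.trans h1
  have hallow : ∀ i s, (c s).Allows i (L i) := by
    refine fun i s => ⟨hL i s, fun x hx hLx => ?_⟩
    have hsx : s ≤ x + 1 := ((hlen s).trans hx).trans x.le_succ
    have := (hext s (x + 1) hsx).stem_allows i x (hlen (x + 1))
    rw [if_neg hx.not_gt] at this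
    exact this hLx
  have hLinf : ∀ i, {x | L i x = true}.Infinite := by
    intro i
    refine Set.infinite_of_forall_exists_gt fun s => ?_
    obtain ⟨x, hx, hx', hsx⟩ := hmem (c (s + 1)) (s + 1) i
    exact ⟨x, (hL i (s + 2) x hx').trans hsx, (hlen (s + 1)).trans hx⟩
  have hLA : ∀ i x, L i x = true → X x = true ∧ A x = i := fun i x h =>
    (c (x + 1)).stem_le i x (hlen (x + 1)) h
  -- If both sets failed, with operators numbered `a` and `b`, the stage coded by the pair `a`, `b`
  -- would have satisfied one of these two requirements.
  obtain ⟨i, hi⟩ : ∃ i, HyperimmuneIn B (L i) := by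
    by_contra! hcon
    have h1 := hcon true
    have h2 := hcon false
    simp only [HyperimmuneIn, not_forall] at h1 h2
    obtain ⟨D1, hD1, h1⟩ := h1
    obtain ⟨D2, hD2, h2⟩ := h2
    obtain ⟨a, rfl⟩ := hE' D1 hD1
    obtain ⟨b, rfl⟩ := hE' D2 hD2
    obtain ⟨i, hi⟩ := hforce (c (Nat.pair a b)) (Nat.pair a b)
    have := hi (L i) (hallow i (Nat.pair a b + 1))
    cases i
    · exact h2 (by simpa [D] using this)
    · exact h1 (by simpa [D] using this)
  exact ⟨L i, hi, hLinf i, i, hLA i⟩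

/-- The pigeonhole principle for finitely many colors strongly preserves hyperimmunity. -/
theorem HyperimmuneIn.exists_monochromatic {X : ℕ → Bool} (hX : HyperimmuneIn B X)
    (hinf : {x | X x = true}.Infinite) (f : ℕ → ℕ) (k : ℕ) (hf : ∀ x, X x = true → f x < k) :
    ∃ L : ℕ → Bool, HyperimmuneIn B L ∧ {x | L x = true}.Infinite ∧
      ∃ j, ∀ x, L x = true → f x = j := by
  induction k generalizing X with
  | zero =>
    obtain ⟨x, hx⟩ := hinf.nonempty
    exact absurd (hf x hx) (Nat.not_lt_zero _)
  | succ k ih =>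
    -- Split off the last color: either `L` has color `k` throughout or it avoids it.
    obtain ⟨L, hL, hLinf, i, hi⟩ := hX.exists_subset_or_disjoint hinf fun x => decide (f x = k)
    cases i
    · refine ih hL hLinf fun x hx => ?_
      have := hf x (hi x hx).1
      have := of_decide_eq_false (hi x hx).2
      omega
    · exact ⟨L, hL, hLinf, k, fun x hx => of_decide_eq_true (hi x hx).2⟩

end Hyperimmune

/-! ### A low hyperimmune set of interval boundaries -/

/-- The code of the coloring of pairs in which `x < y` have color `1` exactly if there is a
boundary `b` with `x < b ≤ y`; the boundaries are the `b` with `χ b = true`. -/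
def intervalCode (χ : ℕ → Bool) (n : ℕ) : ℕ :=
  if ∃ b ≤ n.unpair.2, n.unpair.1 < b ∧ χ b = true then 1 else 0

/-- The initial segment of `intervalCode χ` that is determined by an initial segment of `χ`. -/
def intervalList (σ : List Bool) : List ℕ :=
  (List.range σ.length).map (intervalCode fun b => σ.getD b false)

theorem getD_initSeg (χ : ℕ → Bool) {m b : ℕ} (h : b < m) : (initSeg χ m).getD b false = χ b := by
  rw [List.getD_eq_getElem?_getD, getElem?_initSeg, if_pos h]
  rfl

/-- The value at `n` depends only on boundaries up to `n.unpair.2 ≤ n`. Thus strings for `χ`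
determine strings of the same length for the coloring, whose jump is the one to be controlled. -/
theorem intervalList_initSeg (χ : ℕ → Bool) (m : ℕ) :
    intervalList (initSeg χ m) = initSeg (intervalCode χ) m := by
  rw [intervalList, length_initSeg]
  refine initSeg_congr fun n hn => ?_
  have : ∀ b ≤ n.unpair.2, (initSeg χ m).getD b false = χ b := fun b hb =>
    getD_initSeg χ ((hb.trans n.unpair_right_le).trans_lt hn)
  simp only [intervalCode]
  congr 1
  exact propext (exists_congr fun b => and_congr_right fun hb => by rw [this b hb])

theorem primrec_intervalList : Primrec intervalList := by
  refine Primrec.list_map (Primrec.list_range.comp Primrec.list_length) ?_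
  refine Primrec.ite ?_ (Primrec.const 1) (Primrec.const 0)
  refine primrecPred_exists_le
    (Primrec.snd.comp (Primrec.unpair.comp Primrec.snd)) (.and ?_ ?_)
  · exact Primrec.nat_lt.comp (Primrec.fst.comp (Primrec.unpair.comp
      (Primrec.snd.comp Primrec.fst))) Primrec.snd
  · exact Primrec.eq.comp ((Primrec.list_getD false).comp (Primrec.fst.comp Primrec.fst)
      Primrec.snd) (Primrec.const true)

theorem eq_initSeg_of_prefix {σ τ : List Bool} (h : σ <+: τ) :
    σ = initSeg (fun b => τ.getD b false) σ.length := by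
  refine List.ext_getElem (by simp) fun i hi _ => ?_
  obtain ⟨ρ, rfl⟩ := h
  simp [initSeg, List.getElem?_append_left hi, hi]

theorem intervalList_prefix {σ τ : List Bool} (h : σ <+: τ) :
    intervalList σ <+: intervalList τ := by
  have hσ := eq_initSeg_of_prefix h
  have hτ := eq_initSeg_of_prefix (List.prefix_refl τ)
  generalize (fun b => τ.getD b false) = χ at hσ hτ
  rw [hσ, hτ, intervalList_initSeg, intervalList_initSeg]
  exact initSeg_prefix _ h.length_le

/-- The binary string with a given code, the empty string if there is none. -/
def decodeBits (n : ℕ) : List Bool := (decode n).getD []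

@[simp] theorem decodeBits_encode (σ : List Bool) : decodeBits (encode σ) = σ := by
  simp [decodeBits]

theorem primrec_decodeBits : Primrec decodeBits :=
  Primrec.option_getD.comp Primrec.decode (Primrec.const [])

theorem exists_universal_code : ∃ p : Code, ∀ (σ : List ℕ) (e n v : ℕ),
    v ∈ evalList σ (ofNatCode e) n ↔ ∃ k, v ∈ Code.evaln k p (encode (e, σ, n)) := by
  obtain ⟨p, hp⟩ := Code.exists_code.1 partrec_evalList
  refine ⟨p, fun σ e n v => ?_⟩
  rw [← Code.evaln_complete, hp]
  simp

/-- Stage `2 e` of the construction: an extension of `σ` that makes the program number `e` halt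
at `e`, if there is one. -/
def haltingExtension (p : Code) (e : ℕ) (σ : List Bool) : Part (List Bool) :=
  Nat.rfindOpt fun t =>
    (Code.evaln t.unpair.1 p
      (encode (e, intervalList (σ ++ decodeBits t.unpair.2), e))).map
        fun _ => σ ++ decodeBits t.unpair.2

/-- Stage `2 e + 1` of the construction: an interval without boundaries, of a length given by the
computable function number `e`. -/
def gapExtension (e : ℕ) (σ : List Bool) : Part (List Bool) :=
  ((ofNat Code e).eval σ.length).map fun v => σ ++ (List.range (v + 1)).map fun _ => false

/-- One stage of the construction, on codes for binary strings. -/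
def stageExtension (p : Code) (x : ℕ) : Part ℕ :=
  bif x.unpair.1.bodd then
    (gapExtension x.unpair.1.div2 (decodeBits x.unpair.2)).map encode
  else (haltingExtension p x.unpair.1.div2 (decodeBits x.unpair.2)).map encode

theorem partrec_haltingExtension (p : Code) : Partrec₂ (haltingExtension p) := by
  refine Partrec.rfindOpt ?_
  have hτ : Primrec fun x : (ℕ × List Bool) × ℕ =>
      x.1.2 ++ decodeBits x.2.unpair.2 :=
    Primrec.list_append.comp (Primrec.snd.comp Primrec.fst) (primrec_decodeBits.comp
      (Primrec.snd.comp (Primrec.unpair.comp Primrec.snd)))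
  have he : Primrec fun x : (ℕ × List Bool) × ℕ => x.1.1 := Primrec.fst.comp Primrec.fst
  exact (Primrec.option_map (Code.primrec_evaln.comp (((Primrec.fst.comp
    (Primrec.unpair.comp Primrec.snd)).pair (Primrec.const p)).pair (Primrec.encode.comp
      (he.pair ((primrec_intervalList.comp hτ).pair he))))) (hτ.comp Primrec.fst).to₂).to_comp

theorem partrec_gapExtension : Partrec₂ gapExtension := by
  refine Partrec.map (Code.eval_part.comp ((Computable.ofNat _).comp Computable.fst)
    (Computable.list_length.comp Computable.snd)) ?_
  exact (Primrec.list_append.comp (Primrec.snd.comp Primrec.fst) (Primrec.list_map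
    (Primrec.list_range.comp (Primrec.succ.comp Primrec.snd)) (Primrec.const false).to₂)).to_comp

theorem partrec_stageExtension (p : Code) : Nat.Partrec (stageExtension p) := by
  have h1 : Computable fun x : ℕ => x.unpair.1 := Computable.fst.comp Computable.unpair
  have h2 : Computable fun x : ℕ => decodeBits x.unpair.2 :=
    primrec_decodeBits.to_comp.comp (Computable.snd.comp Computable.unpair)
  refine Partrec.nat_iff.1 (.cond (Computable.nat_bodd.comp h1) (.map ?_ ?_) (.map ?_ ?_))
  · exact partrec_gapExtension.comp (Computable.nat_div2.comp h1) h2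
  · exact (Computable.encode.comp Computable.snd).to₂
  · exact (partrec_haltingExtension p).comp (Computable.nat_div2.comp h1) h2
  · exact (Computable.encode.comp Computable.snd).to₂

theorem prefix_of_mem_haltingExtension {p : Code} {e : ℕ} {σ τ : List Bool}
    (h : τ ∈ haltingExtension p e σ) :
    σ <+: τ ∧ ∃ k v, v ∈ Code.evaln k p (encode (e, intervalList τ, e)) := by
  obtain ⟨t, ht⟩ := Nat.rfindOpt_spec h
  obtain ⟨v, hv, rfl⟩ := Option.map_eq_some_iff.1 ht
  exact ⟨List.prefix_append _ _, _, v, hv⟩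

theorem haltingExtension_dom {p : Code} {e : ℕ} {σ τ : List Bool} (hστ : σ <+: τ) {k v : ℕ}
    (h : v ∈ Code.evaln k p (encode (e, intervalList τ, e))) :
    (haltingExtension p e σ).Dom := by
  obtain ⟨ρ, rfl⟩ := hστ
  refine Nat.rfindOpt_dom.2 ⟨Nat.pair k (encode ρ), σ ++ ρ, ?_⟩
  simp only [Nat.unpair_pair, decodeBits_encode, Option.mem_def, Option.map_eq_some_iff]
  exact ⟨v, h, trivial⟩

/-- The string that is reached after `s` stages, given the values of the stages. -/
noncomputable def stageCode (p : Code) (s : ℕ) : ℕ :=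
  Nat.rec (encode ([] : List Bool)) (fun s w =>
    -- The value `0` of `totalize` signals a divergent stage, which keeps the string; other values
    -- are shifted by one. The final `true` puts a boundary at every stage and keeps the set
    -- infinite.
    encode (decodeBits (if totalize (stageExtension p) (Nat.pair s w) = 0 then w
      else totalize (stageExtension p) (Nat.pair s w) - 1) ++ [true])) s

/-- The string that is reached after `s` stages. -/
noncomputable def stage (p : Code) (s : ℕ) : List Bool := decodeBits (stageCode p s)

theorem recursiveIn_stageCode (p : Code) :
    Nat.RecursiveIn {(haltingFn : ℕ →. ℕ)} (stageCode p : ℕ →. ℕ) := by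
  let N : ℕ → ℕ := fun x => encode (decodeBits
    (if x.unpair.1 = 0 then x.unpair.2.unpair.2 else x.unpair.1 - 1) ++ [true])
  have hN : Primrec N := by
    have h1 : Primrec fun x : ℕ => x.unpair.1 := Primrec.fst.comp Primrec.unpair
    refine Primrec.encode.comp (Primrec.list_concat.comp (primrec_decodeBits.comp
      (Primrec.ite (Primrec.eq.comp h1 (Primrec.const 0)) ?_ ?_)) (Primrec.const true))
    · exact Primrec.snd.comp (Primrec.unpair.comp (Primrec.snd.comp Primrec.unpair))
    · exact Primrec.nat_sub.comp h1 (Primrec.const 1)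
  have h : Nat.RecursiveIn {(haltingFn : ℕ →. ℕ)}
      ((fun x => N (Nat.pair (totalize (stageExtension p) x) x) : ℕ → ℕ) : ℕ →. ℕ) :=
    recursiveIn_comp (recursiveIn_of_computable hN.to_comp) (recursiveIn_pair
      (recursiveIn_totalize (partrec_stageExtension p))
      (recursiveIn_of_computable Computable.id))
  have := recursiveIn_nat_rec (a := encode ([] : List Bool)) h
  simp only [N, Nat.unpair_pair] at this
  exact this

theorem stage_succ_eq (p : Code) (s : ℕ) :
    stage p (s + 1) =
      decodeBits (if totalize (stageExtension p) (Nat.pair s (stageCode p s)) = 0 then stageCode p s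
        else totalize (stageExtension p) (Nat.pair s (stageCode p s)) - 1) ++ [true] :=
  decodeBits_encode _

theorem stage_succ_of_mem {p : Code} {s : ℕ} {τ : List Bool}
    (h : encode τ ∈ stageExtension p (Nat.pair s (stageCode p s))) :
    stage p (s + 1) = τ ++ [true] := by
  simp [stage_succ_eq, totalize_of_mem h]

theorem stage_succ_of_not_dom {p : Code} {s : ℕ}
    (h : ¬ (stageExtension p (Nat.pair s (stageCode p s))).Dom) :
    stage p (s + 1) = stage p s ++ [true] := by
  rw [stage_succ_eq, totalize_eq_zero_iff.2 h, if_pos rfl, stage]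

theorem stageExtension_even (p : Code) (e : ℕ) :
    stageExtension p (Nat.pair (2 * e) (stageCode p (2 * e))) =
      (haltingExtension p e (stage p (2 * e))).map encode := by
  simp [stageExtension, stage, Nat.div2_val]

theorem stageExtension_odd (p : Code) (e : ℕ) :
    stageExtension p (Nat.pair (2 * e + 1) (stageCode p (2 * e + 1))) =
      (gapExtension e (stage p (2 * e + 1))).map encode := by
  simp [stageExtension, stage, Nat.div2_val]

theorem stage_succ (p : Code) (s : ℕ) :
    ∃ τ, stage p s <+: τ ∧ stage p (s + 1) = τ ++ [true] := by
  by_cases h : (stageExtension p (Nat.pair s (stageCode p s))).Dom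
  · obtain ⟨w, hw⟩ := Part.dom_iff_mem.1 h
    obtain ⟨e, rfl | rfl⟩ := s.even_or_odd'
    · have hw' := hw
      rw [stageExtension_even] at hw'
      obtain ⟨τ, hτ, rfl⟩ := (Part.mem_map_iff _).1 hw'
      exact ⟨τ, (prefix_of_mem_haltingExtension hτ).1, stage_succ_of_mem hw⟩
    · have hw' := hw
      rw [stageExtension_odd] at hw'
      obtain ⟨τ, hτ, rfl⟩ := (Part.mem_map_iff _).1 hw'
      refine ⟨τ, ?_, stage_succ_of_mem hw⟩
      obtain ⟨v, _, rfl⟩ := (Part.mem_map_iff _).1 hτ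
      exact List.prefix_append _ _
  · exact ⟨_, List.prefix_refl _, stage_succ_of_not_dom h⟩

theorem stage_prefix (p : Code) {s t : ℕ} (h : s ≤ t) : stage p s <+: stage p t := by
  induction t, h using Nat.le_induction with
  | base => exact List.prefix_refl _
  | succ t _ ih =>
    obtain ⟨τ, hτ, h⟩ := stage_succ p t
    exact ih.trans (h ▸ hτ.trans (List.prefix_append _ _))

theorem le_length_stage (p : Code) (s : ℕ) : s ≤ (stage p s).length := by
  induction s with
  | zero => exact Nat.zero_le _
  | succ s ih =>
    obtain ⟨τ, hτ, h⟩ := stage_succ p s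
    have := hτ.length_le
    rw [h, List.length_append, List.length_singleton]
    omega

/-- The limit of the stages. -/
noncomputable def boundary (p : Code) (n : ℕ) : Bool := (stage p (n + 1)).getD n false

theorem boundary_eq {p : Code} {s n : ℕ} (h : n < (stage p s).length) :
    boundary p n = (stage p s)[n] := by
  have h' : n < (stage p (n + 1)).length := le_length_stage p (n + 1)
  rw [boundary, List.getD_eq_getElem _ _ h']
  rcases le_total s (n + 1) with hs | hs
  · exact ((stage_prefix p hs).getElem h).symm
  · exact (stage_prefix p hs).getElem h'

theorem stage_eq_initSeg (p : Code) (s : ℕ) :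
    stage p s = initSeg (boundary p) (stage p s).length := by
  refine List.ext_getElem (by simp) fun i hi _ => ?_
  simp [initSeg, boundary_eq hi]

theorem infinite_boundary (p : Code) : {b | boundary p b = true}.Infinite := by
  refine Set.infinite_of_forall_exists_gt fun s => ?_
  obtain ⟨τ, hτ, h⟩ := stage_succ p (s + 1)
  have hs := (le_length_stage p (s + 1)).trans hτ.length_le
  refine ⟨τ.length, ?_, hs⟩
  have hlt : τ.length < (stage p (s + 1 + 1)).length := by simp [h]
  change boundary p τ.length = true
  rw [boundary_eq hlt]
  simp [h]

/-- At the odd stage for `φ`, with string `σ`, the positions from `σ.length` to `σ.length + φ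
σ.length` receive `false`, and these cover the interval for `n = σ.length`. -/
theorem exists_disjoint_boundary (p : Code) {φ : ℕ → ℕ} (hφ : Computable φ) :
    ∃ n, Disjoint {b | boundary p b = true} (Set.Icc n (φ n)) := by
  obtain ⟨c, hc⟩ := Code.exists_code.1 (Partrec.nat_iff.1 hφ.partrec)
  let e := encode c
  let σ := stage p (2 * e + 1)
  let τ := σ ++ (List.range (φ σ.length + 1)).map fun _ => false
  have hτ : stage p (2 * e + 1 + 1) = τ ++ [true] := by
    refine stage_succ_of_mem ?_
    rw [stageExtension_odd]
    refine (Part.mem_map_iff _).2 ⟨τ, (Part.mem_map_iff _).2 ⟨φ σ.length, ?_, rfl⟩, rfl⟩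
    simp [e, σ, hc]
  refine ⟨σ.length, Set.disjoint_left.2 fun b hb hbI => ?_⟩
  have hlen : τ.length = σ.length + (φ σ.length + 1) := by simp [τ]
  have hbτ : b < τ.length := by
    rw [hlen]
    have := hbI.2
    omega
  have hlt : b < (stage p (2 * e + 1 + 1)).length := by
    rw [hτ, List.length_append]
    omega
  have hb' : boundary p b = true := hb
  rw [boundary_eq hlt] at hb'
  simp only [hτ, List.getElem_append_left hbτ, τ, List.getElem_append_right hbI.1] at hb'
  simp at hb'

/-- Forcing the jump: stage `2 * e` makes program `e` halt if any extension does. If none does, no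
later stage can make it halt, since a halting computation uses a finite segment. -/
theorem mem_jump_iff {p : Code} (hp : ∀ (σ : List ℕ) (e n v : ℕ),
    v ∈ evalList σ (ofNatCode e) n ↔ ∃ k, v ∈ Code.evaln k p (encode (e, σ, n))) (e : ℕ) :
    e ∈ jump (intervalCode (boundary p)) ↔
      (stageExtension p (Nat.pair (2 * e) (stageCode p (2 * e)))).Dom := by
  have hmap : (stageExtension p (Nat.pair (2 * e) (stageCode p (2 * e)))).Dom ↔
      (haltingExtension p e (stage p (2 * e))).Dom := by
    rw [stageExtension_even]
    exact Iff.rfl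
  have hseg : ∀ s, intervalList (stage p s) =
      initSeg (intervalCode (boundary p)) (stage p s).length := fun s => by
    rw [← intervalList_initSeg, ← stage_eq_initSeg]
  change (eval _ _ _).Dom ↔ _
  rw [Part.dom_iff_mem]
  constructor
  · rintro ⟨v, hv⟩
    obtain ⟨m, hm⟩ := mem_eval_iff.1 hv
    rw [hmap]
    have h1 := (le_max_left m (2 * e)).trans (le_length_stage p (max m (2 * e)))
    have h2 := evalList_mono (initSeg_prefix (intervalCode (boundary p)) h1) hm
    rw [← hseg] at h2
    obtain ⟨k, hk⟩ := (hp _ _ _ _).1 h2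
    exact haltingExtension_dom (stage_prefix p (le_max_right m (2 * e))) hk
  · intro h
    obtain ⟨τ, hτ⟩ := Part.dom_iff_mem.1 (hmap.1 h)
    obtain ⟨-, k, v, hk⟩ := prefix_of_mem_haltingExtension hτ
    have hs : stage p (2 * e + 1) = τ ++ [true] := stage_succ_of_mem <| by
      rw [stageExtension_even]
      exact Part.mem_map _ hτ
    refine ⟨v, mem_eval_iff.2 ⟨(stage p (2 * e + 1)).length, ?_⟩⟩
    rw [← hseg (2 * e + 1), hs]
    exact evalList_mono (intervalList_prefix (List.prefix_append τ [true]))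
      ((hp _ _ _ _).2 ⟨k, hk⟩)

theorem exists_low_boundary : ∃ χ : ℕ → Bool, {b | χ b = true}.Infinite ∧ Low (intervalCode χ) ∧
    ∀ φ : ℕ → ℕ, Computable φ → ∃ n, Disjoint {b | χ b = true} (Set.Icc n (φ n)) := by
  obtain ⟨p, hp⟩ := exists_universal_code
  refine ⟨boundary p, infinite_boundary p, ?_, fun φ => exists_disjoint_boundary p⟩
  have hd : Nat.RecursiveIn {(haltingFn : ℕ →. ℕ)} ((fun e : ℕ => 2 * e : ℕ → ℕ) : ℕ →. ℕ) :=
    recursiveIn_of_computable Primrec.nat_double.to_comp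
  have hsg : Computable fun x : ℕ => if x = 0 then 0 else 1 :=
    (Primrec.ite (Primrec.eq.comp Primrec.id (Primrec.const 0)) (Primrec.const 0)
      (Primrec.const 1)).to_comp
  have h := recursiveIn_comp (recursiveIn_of_computable hsg) <|
    recursiveIn_comp (recursiveIn_totalize (partrec_stageExtension p)) <|
      recursiveIn_pair hd (recursiveIn_comp (recursiveIn_stageCode p) hd)
  refine RecursiveIn.iff_nat.2 (h.of_eq fun e => ?_)
  have := mem_jump_iff hp e
  have := totalize_eq_zero_iff (G := stageExtension p) (x := Nat.pair (2 * e) (stageCode p (2 * e)))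
  simp only [PFun.coe_val, Part.some_inj, charFn, Set.indicator]
  by_cases he : e ∈ jump (intervalCode (boundary p)) <;> simp_all

/-- Over a computable oracle, an operator that answers every `n` yields a computable function by
taking the first answer found. -/
theorem hyperimmuneIn_const_of_computable {B : Set ℕ}
    (h : ∀ φ : ℕ → ℕ, Computable φ → ∃ n, Disjoint B (Set.Icc n (φ n))) :
    HyperimmuneIn B fun _ => true := by
  rintro D ⟨_, hD⟩ htot
  have hD' : PrimrecPred D := ⟨_, hD⟩
  have hex : ∀ n, ∃ t : ℕ, D (initSeg (fun _ => true) t.unpair.2, n, t.unpair.1) := fun n => by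
    obtain ⟨v, m, hvm⟩ := htot n
    exact ⟨Nat.pair v m, by simpa using hvm⟩
  have hcomp : ComputablePred fun x : ℕ × ℕ =>
      D (initSeg (fun _ => true) x.2.unpair.2, x.1, x.2.unpair.1) := by
    refine (hD'.comp (f := fun x : ℕ × ℕ =>
      (initSeg (fun _ => true) x.2.unpair.2, x.1, x.2.unpair.1)) ?_).computablePred
    have hu : Primrec fun x : ℕ × ℕ => x.2.unpair := Primrec.unpair.comp Primrec.snd
    exact (Primrec.list_map (Primrec.list_range.comp (Primrec.snd.comp hu))
      (Primrec.const true).to₂).pair (Primrec.fst.pair (Primrec.fst.comp hu))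
  obtain ⟨n, hn⟩ := h _ (Computable.fst.comp (Computable.unpair.comp (Computable.find hcomp hex)))
  exact ⟨n, _, _, Nat.find_spec (hex n), hn⟩

/-! ### Homogeneous and limit-homogeneous sets -/

theorem charFn_eq_one_iff {A : Set ℕ} {x : ℕ} : charFn A x = 1 ↔ x ∈ A := by
  by_cases h : x ∈ A <;> simp [charFn, h]

namespace Coloring

variable {k : ℕ}

theorem code_pair (c : Coloring k) {x y : ℕ} (h : x < y) :
    c.code (Nat.pair x y) = c.color h := by
  simp [code, h]

theorem color_eq_of_code_eq {c c' : Coloring k} (h : c.code = c'.code) {x y : ℕ} (hxy : x < y) :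
    c.color hxy = c'.color hxy := by
  apply Fin.ext
  rw [← code_pair, ← code_pair, h]

theorem IsStable.of_code_eq {c c' : Coloring k} (h : c.code = c'.code) (hc : c.IsStable) :
    c'.IsStable := by
  intro x
  obtain ⟨j, z, hz⟩ := hc x
  exact ⟨j, z, fun y hxy hy => by rw [← color_eq_of_code_eq h, hz y hxy hy]⟩

theorem isHomogeneous_iff {c : Coloring k} {H : Set ℕ} : c.IsHomogeneous H ↔
    ∃ j, ∀ (x y : ℕ) (h : x < y), x ∈ H → y ∈ H → c.color h = j := by
  refine exists_congr fun j => ⟨fun hj x y h hx hy => ?_, fun hj F hF => ?_⟩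
  · refine hj _ ?_
    simp [Set.insert_subset_iff, hx, hy]
  · obtain ⟨F, hF2⟩ := F
    obtain ⟨x, y, hxy, rfl⟩ := Finset.card_eq_two.1 hF2
    have hx : x ∈ H := hF (by simp)
    have hy : y ∈ H := hF (by simp)
    rcases lt_or_gt_of_ne hxy with h | h
    · exact hj x y h hx hy
    · rw [← hj y x h hy hx]
      exact congrArg c (Subtype.ext (Finset.pair_comm x y))

theorem IsHomogeneous.isLimitHomogeneous {c : Coloring k} (hc : c.IsStable) {H : Set ℕ}
    (hH : c.IsHomogeneous H) (hinf : H.Infinite) : c.IsLimitHomogeneous H := by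
  obtain ⟨j, hj⟩ := isHomogeneous_iff.1 hH
  refine ⟨j, fun x hx => ?_⟩
  obtain ⟨i, z, hz⟩ := hc x
  obtain ⟨y, hy, hlt⟩ := hinf.exists_gt (max x z)
  have hxy : x < y := (le_max_left x z).trans_lt hlt
  have hij : i = j := by
    rw [← hz y hxy ((le_max_right x z).trans hlt.le), hj x y hxy hx hy]
  exact ⟨z, hij ▸ hz⟩

/-! ### Thinning a limit-homogeneous set -/

/-- The elements below `n` of the homogeneous set of color `j` that is obtained greedily from the
set coded by the list `l`, with respect to the coloring coded by the list `d`. -/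
def greedyList (j : ℕ) (d l : List ℕ) (n : ℕ) : List ℕ :=
  Nat.rec [] (fun x s =>
    if l[x]? = some 1 ∧ ∀ y ∈ s, d[Nat.pair y x]? = some j then s ++ [x] else s) n

theorem primrec_greedyList (j : ℕ) :
    Primrec fun x : (List ℕ × List ℕ) × ℕ => greedyList j x.1.1 x.1.2 x.2 := by
  refine Primrec.nat_rec' (f := fun x : (List ℕ × List ℕ) × ℕ => x.2) Primrec.snd
    (Primrec.const []) (h := fun x p => if x.1.2[p.1]? = some 1 ∧
      ∀ y ∈ p.2, x.1.1[Nat.pair y p.1]? = some j then p.2 ++ [p.1] else p.2) ?_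
  have hs : Primrec fun z : ((List ℕ × List ℕ) × ℕ) × ℕ × List ℕ => z.2.2 :=
    Primrec.snd.comp Primrec.snd
  have hx : Primrec fun z : ((List ℕ × List ℕ) × ℕ) × ℕ × List ℕ => z.2.1 :=
    Primrec.fst.comp Primrec.snd
  refine Primrec.ite (.and ?_ (primrecPred_forall_mem hs ?_)) (Primrec.list_concat.comp hs hx) hs
  · exact Primrec.eq.comp (Primrec.list_getElem?.comp (Primrec.snd.comp
      (Primrec.fst.comp Primrec.fst)) hx) (Primrec.const _)
  · exact Primrec.eq.comp (Primrec.list_getElem?.comp (Primrec.fst.comp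
      (Primrec.fst.comp (Primrec.fst.comp Primrec.fst)))
      (Primrec₂.natPair.comp Primrec.snd (hx.comp Primrec.fst))) (Primrec.const _)

/-- The homogeneous set of color `j` obtained greedily from the set `L`. -/
def greedySet (c : Coloring k) (j : Fin k) (L : Set ℕ) : Set ℕ :=
  {x | x ∈ greedyList j (initSeg c.code (Nat.pair x x + 1)) (initSeg (charFn L) (x + 1)) (x + 1)}

/-- The lengths `a` and `b` are arbitrary because `greedySet` uses lists whose lengths vary with the
element tested; any sufficiently long lists give the same decisions. -/
theorem mem_greedyList_succ {c : Coloring k} {j : Fin k} {L : Set ℕ} {n a b : ℕ}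
    (ha : Nat.pair n n < a) (hb : n < b)
    (hn : ∀ x, x ∈ greedyList j (initSeg c.code a) (initSeg (charFn L) b) n ↔
      x < n ∧ x ∈ greedySet c j L) (x : ℕ) :
    x ∈ greedyList j (initSeg c.code a) (initSeg (charFn L) b) (n + 1) ↔
      (x < n ∧ x ∈ greedySet c j L) ∨ (x = n ∧ n ∈ L ∧ ∀ y, y < n → y ∈ greedySet c j L →
        c.code (Nat.pair y n) = j) := by
  change x ∈ ite _ _ _ ↔ _
  have hc : ((initSeg (charFn L) b)[n]? = some 1 ∧
      ∀ y ∈ greedyList j (initSeg c.code a) (initSeg (charFn L) b) n,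
        (initSeg c.code a)[Nat.pair y n]? = some (j : ℕ)) ↔
      (n ∈ L ∧ ∀ y, y < n → y ∈ greedySet c j L → c.code (Nat.pair y n) = j) := by
    rw [getElem?_initSeg, if_pos hb, Option.some_inj, charFn_eq_one_iff]
    refine and_congr_right fun _ => forall_congr' fun y => ?_
    rw [hn, and_imp]
    refine forall_congr' fun hy => imp_congr_right fun _ => ?_
    rw [getElem?_initSeg, if_pos ((Nat.pair_lt_pair_left n hy).trans ha), Option.some_inj]
  split_ifs with h
  · rw [List.mem_append, List.mem_singleton]
    exact or_congr (hn x) (iff_self_and.2 fun _ => hc.1 h)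
  · exact (hn x).trans (or_iff_left fun h' => h (hc.2 h'.2)).symm

theorem mem_greedyList_iff {c : Coloring k} {j : Fin k} {L : Set ℕ} {n a b : ℕ}
    (ha : Nat.pair n n ≤ a) (hb : n ≤ b) {x : ℕ} :
    x ∈ greedyList j (initSeg c.code a) (initSeg (charFn L) b) n ↔ x < n ∧ x ∈ greedySet c j L := by
  induction n generalizing a b x with
  | zero => simp [greedyList]
  | succ n ih =>
    have step {a b : ℕ} (ha : Nat.pair n n < a) (hb : n < b) :=
      mem_greedyList_succ ha hb fun _ => ih ha.le hb.le
    have hself := step (Nat.lt_succ_self _) n.lt_succ_self n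
    rw [step ((Nat.pair_lt_pair_left n n.lt_succ_self).trans
      ((Nat.pair_lt_pair_right _ n.lt_succ_self).trans_le ha)) hb]
    constructor
    · rintro (⟨h, h'⟩ | ⟨rfl, h⟩)
      · exact ⟨h.trans n.lt_succ_self, h'⟩
      · exact ⟨x.lt_succ_self, hself.2 (.inr ⟨rfl, h⟩)⟩
    · rintro ⟨h, h'⟩
      rcases Nat.lt_succ_iff_lt_or_eq.1 h with h | rfl
      · exact .inl ⟨h, h'⟩
      · exact .inr ((hself.1 h').resolve_left fun h => lt_irrefl _ h.1)

theorem mem_greedySet_iff {c : Coloring k} {j : Fin k} {L : Set ℕ} {x : ℕ} :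
    x ∈ greedySet c j L ↔
      x ∈ L ∧ ∀ y, y < x → y ∈ greedySet c j L → c.code (Nat.pair y x) = j := by
  refine (mem_greedyList_succ (Nat.lt_succ_self _) x.lt_succ_self (fun _ =>
    mem_greedyList_iff (Nat.le_succ _) x.le_succ) x).trans ?_
  simp

/-- An infinite limit-homogeneous set and the coloring together compute an infinite homogeneous
set. -/
theorem IsLimitHomogeneous.exists_isHomogeneous {c : Coloring k} {L : Set ℕ}
    (hL : c.IsLimitHomogeneous L) (hinf : L.Infinite) {O : Set (ℕ →. ℕ)}
    (hOc : Nat.RecursiveIn O c.code) (hOL : Nat.RecursiveIn O (charFn L)) :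
    ∃ H : Set ℕ, H.Infinite ∧ c.IsHomogeneous H ∧ Nat.RecursiveIn O (charFn H) := by
  obtain ⟨j, hj⟩ := hL
  refine ⟨greedySet c j L, fun hfin => ?_, isHomogeneous_iff.2 ⟨j, fun x y h hx hy => ?_⟩, ?_⟩
  -- Were the greedy set finite, an element of `L` beyond all its members and their stabilization
  -- points would be admitted as well.
  · have hz : ∀ y, ∃ z, y ∈ greedySet c j L → ∀ (x : ℕ) (h : y < x), z ≤ x → c.color h = j := by
      intro y
      by_cases hy : y ∈ greedySet c j L
      · obtain ⟨z, hz⟩ := hj y (mem_greedySet_iff.1 hy).1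
        exact ⟨z, fun _ => hz⟩
      · exact ⟨0, fun h => absurd h hy⟩
    choose z hz using hz
    obtain ⟨N, hN⟩ := hfin.bddAbove
    obtain ⟨M, hM⟩ := (hfin.image z).bddAbove
    obtain ⟨x, hx, hlt⟩ := hinf.exists_gt (max N M)
    refine ((hN (mem_greedySet_iff.2 ⟨hx, fun y hyx hy => ?_⟩)).trans
      (le_max_left N M)).not_gt hlt
    rw [code_pair c hyx, hz y hy x hyx
      ((hM ⟨y, hy, rfl⟩).trans ((le_max_right N M).trans hlt.le))]
  · exact Fin.ext ((code_pair c h).symm.trans ((mem_greedySet_iff.1 hy).2 x h hx))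
  -- The input codes a segment of the coloring, a segment of `L`, and the number to be tested.
  · let Φ : ℕ → ℕ := fun w =>
      if w.unpair.2.unpair.2 ∈ greedyList j (ofNat (List ℕ) w.unpair.1)
        (ofNat (List ℕ) w.unpair.2.unpair.1) (w.unpair.2.unpair.2 + 1) then 1 else 0
    have hΦ : Primrec Φ := by
      have h2 : Primrec fun w : ℕ => w.unpair.2.unpair :=
        Primrec.unpair.comp (Primrec.snd.comp Primrec.unpair)
      refine Primrec.ite ((primrecPred_exists_mem (l := fun w : ℕ => greedyList j
        (ofNat (List ℕ) w.unpair.1) (ofNat (List ℕ) w.unpair.2.unpair.1) (w.unpair.2.unpair.2 + 1))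
        (p := fun w y => y = w.unpair.2.unpair.2)
        ?_ ?_).of_eq fun w => by simp only [exists_eq_right]) (Primrec.const 1) (Primrec.const 0)
      · exact (primrec_greedyList j).comp ((((Primrec.ofNat _).comp
          (Primrec.fst.comp Primrec.unpair)).pair ((Primrec.ofNat _).comp
            (Primrec.fst.comp h2))).pair (Primrec.succ.comp (Primrec.snd.comp h2)))
      · exact Primrec.eq.comp Primrec.snd (Primrec.snd.comp (h2.comp Primrec.fst))
    have hp : Computable fun x : ℕ => Nat.pair x x + 1 :=
      (Primrec.succ.comp (Primrec₂.natPair.comp Primrec.id Primrec.id)).to_comp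
    have h := recursiveIn_comp (recursiveIn_of_computable hΦ.to_comp) <| recursiveIn_pair
      (recursiveIn_comp (recursiveIn_initSeg hOc) (recursiveIn_of_computable hp)) <|
      recursiveIn_pair (recursiveIn_comp (recursiveIn_initSeg hOL)
        (recursiveIn_of_computable Computable.succ)) (recursiveIn_of_computable Computable.id)
    refine h.of_eq fun x => ?_
    simp only [PFun.coe_val, Part.some_inj, Φ, Nat.unpair_pair, ofNat_encode, charFn,
      Set.indicator]
    by_cases hx : x ∈ greedySet c j L
    · rw [if_pos hx]
      exact if_pos hx
    · rw [if_neg hx]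
      exact if_neg hx

end Coloring

open Coloring

/-! ### The two reductions and the computable case -/

theorem srt2_computablyReducible_d2 (k : ℕ) : ComputablyReducible (SRT2 k) (D2 k) := by
  rintro X ⟨c, hc, rfl⟩
  refine ⟨c.code, ⟨c, hc, rfl⟩, TuringReducible.refl _, ?_⟩
  rintro Y' ⟨c', hcc', L, hinf, hL, rfl⟩
  obtain ⟨H, hHinf, hH, hrec⟩ := hL.exists_isHomogeneous (O := {(c.code : ℕ →. ℕ),
    (charFn L : ℕ →. ℕ)}) hinf (.oracle _ (by simp [hcc'])) (.oracle _ (by simp))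
  exact ⟨charFn H, ⟨c', hcc', H, hHinf, hH, rfl⟩, RecursiveIn.iff_nat.2 hrec⟩

theorem d2_computablyReducible_srt2 (k : ℕ) : ComputablyReducible (D2 k) (SRT2 k) := by
  rintro X ⟨c, hc, rfl⟩
  refine ⟨c.code, ⟨c, hc, rfl⟩, TuringReducible.refl _, ?_⟩
  rintro Y' ⟨c', hcc', H, hinf, hH, rfl⟩
  exact ⟨charFn H, ⟨c', hcc', H, hinf, hH.isLimitHomogeneous (hc.of_code_eq hcc') hinf, rfl⟩,
    RecursiveIn.iff_nat.2 (.oracle _ (by simp))⟩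

/-- Take `d = c`: when `c` is computable, a limit-homogeneous set for `c` thins itself to a
homogeneous one with no further oracle. -/
theorem not_avoidsAllStable_of_computable {c : Coloring 2} (hc : c.IsStable)
    (hcomp : Computable c.code) : ¬ AvoidsAllStable c := by
  intro h
  obtain ⟨L, hinf, hL, hno⟩ := h 2 le_rfl c hc
  obtain ⟨H, hHinf, hH, hrec⟩ := hL.exists_isHomogeneous (O := {(charFn L : ℕ →. ℕ)}) hinf
    (recursiveIn_of_computable hcomp) (.oracle _ rfl)
  exact hno H hHinf hH (RecursiveIn.iff_nat.2 hrec)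

/-! ### The low coloring -/

open Classical in
/-- The coloring in which `x < y` have color `1` exactly if there is a boundary `b` with
`x < b ≤ y`; the boundaries are the `b` with `χ b = true`. -/
noncomputable def intervalColoring (χ : ℕ → Bool) : Coloring 2 := fun F =>
  if ∃ x ∈ (F : Finset ℕ), ∃ y ∈ (F : Finset ℕ), ∃ b, x < b ∧ b ≤ y ∧ χ b = true then 1 else 0

theorem intervalColoring_color_eq_one_iff (χ : ℕ → Bool) {x y : ℕ} (h : x < y) :
    (intervalColoring χ).color h = 1 ↔ ∃ b, x < b ∧ b ≤ y ∧ χ b = true := by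
  have : (∃ u ∈ ({x, y} : Finset ℕ), ∃ v ∈ ({x, y} : Finset ℕ), ∃ b, u < b ∧ b ≤ v ∧ χ b = true) ↔
      ∃ b, x < b ∧ b ≤ y ∧ χ b = true := by
    constructor
    · rintro ⟨u, hu, v, hv, b, hub, hbv, hb⟩
      rw [Finset.mem_insert, Finset.mem_singleton] at hu hv
      exact ⟨b, by omega, by omega, hb⟩
    · rintro ⟨b, hb⟩
      exact ⟨x, by simp, y, by simp, b, hb⟩
  rw [← this, color, intervalColoring]
  split_ifs with h'
  · exact iff_of_true rfl h'
  · exact iff_of_false zero_ne_one h'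

theorem code_intervalColoring (χ : ℕ → Bool) :
    (intervalColoring χ).code = intervalCode χ := by
  funext n
  have h := intervalColoring_color_eq_one_iff χ (x := n.unpair.1) (y := n.unpair.2)
  simp only [code, intervalCode]
  by_cases hlt : n.unpair.1 < n.unpair.2
  · rw [dif_pos hlt]
    have h' : (∃ b ≤ n.unpair.2, n.unpair.1 < b ∧ χ b = true) ↔
        (intervalColoring χ).color hlt = 1 :=
      (exists_congr fun b => and_left_comm).trans (h hlt).symm
    rw [if_congr h' rfl rfl]
    generalize (intervalColoring χ).color hlt = i
    fin_cases i <;> rfl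
  · rw [dif_neg hlt, if_neg]
    rintro ⟨b, hb, hb', -⟩
    omega

theorem hasLimit_intervalColoring {χ : ℕ → Bool} (hχ : {b | χ b = true}.Infinite) (x : ℕ) :
    (intervalColoring χ).HasLimit x 1 := by
  obtain ⟨b, hb, hxb⟩ := hχ.exists_gt x
  exact ⟨b, fun y h hby => (intervalColoring_color_eq_one_iff χ h).2 ⟨b, hxb, hby, hb⟩⟩

/-- Comparing `x` with a far element of `H` shows that the color of `H` is the limit color `1`. -/
theorem exists_boundary_of_isHomogeneous {χ : ℕ → Bool} (hχ : {b | χ b = true}.Infinite)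
    {H : Set ℕ} (hinf : H.Infinite) (hH : (intervalColoring χ).IsHomogeneous H) {x y : ℕ}
    (hx : x ∈ H) (hy : y ∈ H) (h : x < y) : ∃ b, x < b ∧ b ≤ y ∧ χ b = true := by
  obtain ⟨j, hj⟩ := isHomogeneous_iff.1 hH
  obtain ⟨z, hz⟩ := hasLimit_intervalColoring hχ x
  obtain ⟨w, hw, hlt⟩ := hinf.exists_gt (max x z)
  have hxw : x < w := (le_max_left x z).trans_lt hlt
  have hj1 : j = 1 := by
    rw [← hz w hxw ((le_max_right x z).trans hlt.le), hj x w hxw hx hw]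
  exact (intervalColoring_color_eq_one_iff χ h).1 (hj1 ▸ hj x y h hx hy)

/-- If `B` is hyperimmune relative to `L`, then `L` computes no infinite set between any two
elements of which there is an element of `B`. -/
theorem HyperimmuneIn.not_setComputes {B : Set ℕ} {L : ℕ → Bool} (hL : HyperimmuneIn B L)
    {H : Set ℕ} (hinf : H.Infinite)
    (hH : ∀ x ∈ H, ∀ y ∈ H, x < y → ∃ b ∈ B, x < b ∧ b ≤ y) :
    ¬ SetComputes {x | L x = true} H := by
  intro hcomp
  obtain ⟨e, he⟩ := exists_code_of_recursiveIn (RecursiveIn.iff_nat.1 hcomp)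
  obtain ⟨D, hD, hD'⟩ := exists_primrecPred e
  have hmem : ∀ x, x ∈ H ↔ ∃ m, D (initSeg (charFn {x | L x = true}) m, x, 1) := fun x => by
    rw [← hD', he, ← charFn_eq_one_iff]
    simp [eq_comm]
  have hL' : HyperimmuneIn B (charFn {x | L x = true}) := by
    have := hL.map (φ := fun b => bif b then 1 else 0) (Primrec.dom_bool _)
    convert this using 2 with n
    cases h : L n <;> simp [charFn, h]
  -- From `n`, search for two elements `x < v` of `H` with `n ≤ x`. Some element of `B` lies in `(x,
  -- v]`, so `v` is always a correct bound, contradicting hyperimmunity.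
  let E : List ℕ × ℕ × ℕ → Prop := fun z => ∃ x < z.2.2, z.2.1 ≤ x ∧
    (∃ k ≤ z.1.length, D (z.1.take k, x, 1)) ∧ ∃ k ≤ z.1.length, D (z.1.take k, z.2.2, 1)
  have hE : PrimrecPred E := by
    refine primrecPred_exists_lt (Primrec.snd.comp Primrec.snd) (.and ?_ (.and ?_ ?_))
    · exact Primrec.nat_le.comp (Primrec.fst.comp (Primrec.snd.comp Primrec.fst)) Primrec.snd
    all_goals
      refine primrecPred_exists_le (Primrec.list_length.comp (Primrec.fst.comp Primrec.fst)) ?_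
      refine hD.comp ((Primrec.list_take.comp Primrec.snd
        (Primrec.fst.comp (Primrec.fst.comp Primrec.fst))).pair (.pair ?_ (Primrec.const 1)))
    · exact Primrec.snd.comp Primrec.fst
    · exact Primrec.snd.comp (Primrec.snd.comp (Primrec.fst.comp Primrec.fst))
  obtain ⟨n, v, m, ⟨x, hxv, hnx, ⟨k, hk, hxk⟩, l, hl, hvl⟩, hdisj⟩ := hL' E hE fun n => by
    obtain ⟨x, hx, hnx⟩ := hinf.exists_gt n
    obtain ⟨y, hy, hxy⟩ := hinf.exists_gt x
    obtain ⟨k, hk⟩ := (hmem x).1 hx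
    obtain ⟨l, hl⟩ := (hmem y).1 hy
    refine ⟨y, max k l, x, hxy, hnx.le, ⟨k, by simp, ?_⟩, l, by simp, ?_⟩
    · rwa [take_initSeg _ (le_max_left k l)]
    · rwa [take_initSeg _ (le_max_right k l)]
  rw [length_initSeg] at hk hl
  simp only [take_initSeg _ hk] at hxk
  simp only [take_initSeg _ hl] at hvl
  obtain ⟨b, hb, hxb, hbv⟩ := hH x ((hmem x).2 ⟨k, hxk⟩) v ((hmem v).2 ⟨l, hvl⟩) hxv
  exact Set.disjoint_left.1 hdisj hb ⟨hnx.trans hxb.le, hbv⟩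

theorem exists_low_avoidsAllStable :
    ∃ c : Coloring 2, c.IsStable ∧ Low c.code ∧ AvoidsAllStable c := by
  obtain ⟨χ, hinf, hlow, hφ⟩ := exists_low_boundary
  refine ⟨intervalColoring χ, fun x => ⟨1, hasLimit_intervalColoring hinf x⟩,
    code_intervalColoring χ ▸ hlow, fun k _ d hd => ?_⟩
  choose f hf using hd
  -- The pigeonhole principle is applied to the set of all numbers, partitioned by the limit colors
  -- of `d`.
  obtain ⟨L, hL, hLinf, j, hj⟩ := (hyperimmuneIn_const_of_computable hφ).exists_monochromatic
    (by simpa using Set.infinite_univ) (fun x => (f x : ℕ)) k fun x _ => (f x).2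
  obtain ⟨x, hx⟩ := hLinf.nonempty
  refine ⟨{x | L x = true}, hLinf, ⟨f x, fun y hy => ?_⟩, fun H hHinf hH => ?_⟩
  · rw [← Fin.ext ((hj y hy).trans (hj x hx).symm)]
    exact hf y
  · refine hL.not_setComputes hHinf fun x hx y hy h => ?_
    obtain ⟨b, hxb, hby, hb⟩ := exists_boundary_of_isHomogeneous hinf hHinf hH hx hy h
    exact ⟨b, hb, hxb, hby⟩

end StableRamsey

open StableRamsey
theorem mainTheorem10 :
    (∃ c : Coloring 2, c.IsStable ∧ Low c.code ∧ AvoidsAllStable c) ∧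
    (ComputablyReducible (SRT2 2) (D2 2) ∧ ComputablyReducible (D2 2) (SRT2 2)) ∧
    ¬ ∃ c : Coloring 2, c.IsStable ∧ Computable c.code ∧ AvoidsAllStable c :=
  ⟨exists_low_avoidsAllStable, ⟨srt2_computablyReducible_d2 2, d2_computablyReducible_srt2 2⟩,
    fun ⟨_, hc, hcomp, h⟩ => not_avoidsAllStable_of_computable hc hcomp h⟩
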